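/- Let $0<\alpha<1$. There is a constant $K>0$ depending only on $\alpha$ such that the following holds. Let $d\in\mathbb N$, let $I_1,\dots,I_d$ be (finite or infinite) index sets, and let $A_i$ be a positive definite self-adjoint, possibly unbounded, operator on $\ell^2(I_i)$ over $\mathbb C$ (for $I_i=\{1,\dots,n_i\}$: a Hermitian positive definite $n_i\times n_i$ matrix), where positive definite means $\langle A_iv,v\rangle>0$ for every $v\neq 0$ in the domain of $A_i$. Let $$\mathcal A=\bigoplus_{i=1}^d A_i=\sum_{i=1}^d I\otimes\cdots\otimes A_i\otimes\cdots\otimes I$$ be their Kronecker sum on $\ell^2(I_1\times\cdots\times I_d)$, i.e. the closure of the operator defined by this formula on the span of the elementary tensors $v_1\otimes\cdots\otimes v_d$ with $v_i$ in the domain of $A_i$. Assume that $\mathcal A$ is invertible, i.e. has a bounded everywhere defined inverse, and put $\mathcal A^{-\alpha}=(\mathcal A^{-1})^{\alpha}$. Let $C\in\ell^2(I_1\times\cdots\times I_d)$ be a tensor, with Frobenius norm $\|C\|_F$ and vectorization $c=\mathrm{vec}(C)$, and let $X$ be the tensor with $\mathrm{vec}(X)=x=\mathcal A^{-\alpha}c$.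 Then for every $N\in\mathbb N$ there is a tensor $X_N$ with $$\|X-X_N\|_F\le K\,\|\mathcal A^{-1}\|^{\alpha}\,\|C\|_F\,e^{-\frac{\pi}{2}\sqrt{\alpha N}}$$ (in particular $\|X-X_N\|_F=O(e^{-\frac{\pi}{2}\sqrt{\alpha N}})$ as $N\to\infty$; note $\|\mathcal A^{-1}\|=\lambda_{\min}^{-1}$, with $\lambda_{\min}>0$ the minimum of the spectrum of $\mathcal A$, unless the space is zero), and such that - if $C$ has CP rank at most $r$, then $X_N$ has CP rank at most $Nr$; - if $C$ has multilinear rank at most $(r_1,\dots,r_d)$ componentwise, then $X_N$ has multilinear rank at most $(Nr_1,\dots,Nr_d)$; - if $C$ has TT-ranks at most $(r_1,\dots,r_{d-1})$ componentwise, then $X_N$ has TT-ranks at most $(Nr_1,\dots,Nr_{d-1})$. Here the CP rank of a tensor is the least number of elementary tensors $u_1\otimes\cdots\otimes u_d$, $u_i\in\ell^2(I_i)$, that sum to it; the $i$-th entry of the multilinear rank is the rank of the matrix with row index the $i$-th tensor index and column index all the others; and the $k$-th TT-rank is the rank of the matrix whose row index is formed by the first $k$ tensor indices and whose column index is formed by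 the remaining ones. -/

import Mathlib

open scoped InnerProductSpace ENNReal

universe u

noncomputable section

namespace FracKron

/-- The Hilbert space `ℓ²(κ)` of complex square-summable families indexed by `κ`.
For `κ = Fin n` this is `ℂⁿ` with the Euclidean norm; since every complex Hilbert space has an
orthonormal basis, every complex Hilbert space is of this form up to a unitary. -/
abbrev Ell2 (κ : Type u) : Type u := lp (fun _ : κ => ℂ) 2

/-- Tensors with `d` modes, the `i`-th index running through `ι i` (for `ι i = Fin (n i)`:
arrays of size `n₁ × ⋯ × n_d`), with the Frobenius norm. A tensor and its vectorization
are the same family of numbers indexed by the tuples `(p₁, …, p_d)`. -/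
abbrev Tensor {d : ℕ} (ι : Fin d → Type u) : Type u := Ell2 (∀ i, ι i)

variable {d : ℕ} {ι : Fin d → Type u}

theorem memℓp_prod (v : ∀ i, Ell2 (ι i)) :
    Memℓp (fun p : ∀ i, ι i => ∏ i, v i (p i)) 2 := by
  classical
  have hs : ∀ i, Summable fun k => ‖v i k‖ ^ 2 := fun i => by
    have := (lp.memℓp (v i)).summable (by norm_num)
    simpa using this
  refine memℓp_gen' (C := ∏ i, ∑' k, ‖v i k‖ ^ 2) fun s => ?_
  calc ∑ p ∈ s, ‖∏ i, v i (p i)‖ ^ (2 : ℝ≥0∞).toReal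
      = ∑ p ∈ s, ∏ i, ‖v i (p i)‖ ^ 2 := by
        simp [norm_prod, Finset.prod_pow]
    _ ≤ ∑ p ∈ Fintype.piFinset fun i => s.image fun p => p i, ∏ i, ‖v i (p i)‖ ^ 2 := by
        refine Finset.sum_le_sum_of_subset_of_nonneg (fun p hp => ?_) fun _ _ _ => by positivity
        exact Fintype.mem_piFinset.2 fun i => Finset.mem_image_of_mem _ hp
    _ = ∏ i, ∑ k ∈ s.image fun p => p i, ‖v i k‖ ^ 2 := by
        rw [Finset.prod_univ_sum]
    _ ≤ ∏ i, ∑' k, ‖v i k‖ ^ 2 :=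
        Finset.prod_le_prod (fun _ _ => Finset.sum_nonneg fun _ _ => by positivity)
          fun i _ => (hs i).sum_le_tsum _ fun _ _ => by positivity

/-- The elementary tensor `v₁ ⊗ ⋯ ⊗ v_d`. -/
def elem (v : ∀ i, Ell2 (ι i)) : Tensor ι :=
  ⟨fun p => ∏ i, v i (p i), memℓp_prod v⟩

/-! ### Kronecker sums of (possibly unbounded) operators -/

/-- The graph of the Kronecker sum on the algebraic tensor product of the domains: the span of
the pairs `(v₁ ⊗ ⋯ ⊗ v_d, ∑ j, v₁ ⊗ ⋯ ⊗ A_j v_j ⊗ ⋯ ⊗ v_d)` with `v_i` in the domain of `A_i`. -/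
def algKroneckerGraph (A : ∀ i, Ell2 (ι i) →ₗ.[ℂ] Ell2 (ι i)) :
    Submodule ℂ (Tensor ι × Tensor ι) :=
  Submodule.span ℂ <| Set.range fun v : ∀ i, (A i).domain =>
    (elem fun i => (v i : Ell2 (ι i)),
      ∑ j, elem (Function.update (fun i => (v i : Ell2 (ι i))) j (A j (v j))))

/-- The Kronecker sum `A₁ ⊕ ⋯ ⊕ A_d = ∑ j, I ⊗ ⋯ ⊗ A_j ⊗ ⋯ ⊗ I`: the closure of the operator
that is defined on the algebraic tensor product of the domains. For self-adjoint `A_i` that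
operator is densely defined and symmetric, hence closable, so the closure of its graph is
the graph of an operator. -/
def kroneckerSum (A : ∀ i, Ell2 (ι i) →ₗ.[ℂ] Ell2 (ι i)) : Tensor ι →ₗ.[ℂ] Tensor ι :=
  (algKroneckerGraph A).topologicalClosure.toLinearPMap

/-- `A` is symmetric positive definite: self-adjoint (in particular densely defined), with
`⟪A v, v⟫ > 0` for all nonzero `v` in its domain. -/
def IsSPD {H : Type u} [NormedAddCommGroup H] [InnerProductSpace ℂ H] [CompleteSpace H]
    (A : H →ₗ.[ℂ] H) : Prop :=
  IsSelfAdjoint A ∧ ∀ v : A.domain, (v : H) ≠ 0 → 0 < (⟪A v, (v : H)⟫_ℂ).re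

/-! ### Inverses and negative fractional powers -/

section Powers

variable {H : Type u} [NormedAddCommGroup H] [InnerProductSpace ℂ H] [CompleteSpace H]

/-- `B` is a bounded two-sided inverse of the operator `T`. -/
def IsBoundedInverse (T : H →ₗ.[ℂ] H) (B : H →L[ℂ] H) : Prop :=
  (∀ y : H, ∃ h : B y ∈ T.domain, T ⟨B y, h⟩ = y) ∧ ∀ x : T.domain, B (T x) = x

/-- `T` is invertible: `0` lies in its resolvent set. -/
def IsInvertible (T : H →ₗ.[ℂ] H) : Prop := ∃ B : H →L[ℂ] H, IsBoundedInverse T B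

open Classical in
/-- The bounded inverse `T⁻¹` of an invertible operator (it is unique). -/
def boundedInverse (T : H →ₗ.[ℂ] H) : H →L[ℂ] H :=
  if h : IsInvertible T then h.choose else 0

/-- `T^{-α} = (T⁻¹)^α` for an invertible positive self-adjoint `T` and `α > 0`; the power of
the bounded positive operator `T⁻¹` is given by the continuous functional calculus. If `T ≥ 0` has spectrum with minimum `λ`, then
`‖T⁻¹‖ = 1 / λ`. -/
def negPow (T : H →ₗ.[ℂ] H) (α : ℝ) : H →L[ℂ] H := boundedInverse T ^ α

end Powers

/-! ### Tensor ranks -/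

/-- The CP rank: the least number of terms in a representation as a sum of elementary
tensors, and `⊤` if there is none. -/
def cpRank (X : Tensor ι) : ℕ∞ :=
  ⨅ (k : ℕ) (_ : ∃ v : Fin k → ∀ i, Ell2 (ι i), X = ∑ s, elem (v s)), (k : ℕ∞)

/-- The `i`-th mode unfolding: the matrix whose row index is the `i`-th index of the tensor and
whose column index collects all the others. -/
def modeUnfolding (X : Tensor ι) (i : Fin d) :
    Matrix (ι i) (∀ j : {j // j ≠ i}, ι j) ℂ :=
  fun a q => X ((Equiv.piSplitAt i ι).symm (a, q))

/-- The multilinear rank: the ranks of the `d` mode unfoldings. -/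
def multilinearRank (X : Tensor ι) (i : Fin d) : ℕ∞ := (modeUnfolding X i).eRank

/-- The matricization that groups the first `k` indices as row index and the remaining
ones as column index. -/
def ttUnfolding (X : Tensor ι) (k : ℕ) :
    Matrix (∀ j : {j : Fin d // j.val < k}, ι j) (∀ j : {j : Fin d // ¬ j.val < k}, ι j) ℂ :=
  fun a q => X ((Equiv.piEquivPiSubtypeProd (fun j : Fin d => j.val < k) ι).symm (a, q))

/-- The TT-ranks `(r₁, …, r_{d-1})`; the entry with index `k : Fin (d - 1)` belongs to the
matricization with `k + 1` row indices. -/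
def ttRank (X : Tensor ι) (k : Fin (d - 1)) : ℕ∞ := (ttUnfolding X (k.val + 1)).eRank

end FracKron

end

noncomputable section

namespace FracKron

/-! ### Exponential sums for negative powers -/

/-! The function `l ^ (-α)` is approximated on `[1, ∞)` by an exponential sum `∑ w_k exp (-t_k l)`
with `N` terms. The summands of `𝒜` act on different modes, so `exp (-t 𝒜)` is the tensor product of
the `exp (-t A_i)`. It therefore maps rank-one terms of each of the three kinds to rank-one terms of
the same kind, and `N` exponentials multiply a rank by at most `N`.

Scalar part (`exists_expSum_approx_rpow_neg`): in logarithmic coordinates `Γ(α) l ^ (-α) = ∫ t ^ (α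
- 1) exp (-l t) dt` becomes an integral over the line, which is discretized with step `h`. By
Poisson summation the discretization error is governed by `Γ` on the vertical line `Re = α`, and a
decay rate `π / 4` there yields `exp (-π² / (2h))`. Keeping `N` nodes costs `exp (-α h N / 2)`. The
choice `h = π / √(αN)` makes both equal to `exp (-(π/2) √(αN))`.

Operator part (`nonneg_and_funCalc_of_isBoundedInverse`): everything is expressed through bounded
operators, namely `B = 𝒜⁻¹` and `R_i = (1 + A_i)⁻¹`. Since `A_j R_j = 1 - R_j`, they satisfy `B * ∑
j, (⨂_{i≠j} R_i) ⊗ (1 - R_j) = ⨂ R_i`. At a character where `⨂ R_i` does not vanish this reads `b⁻¹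
= ∑ (r_j⁻¹ - 1)`, so `exp (-t / b)` factors. Characters where it vanishes are harmless: the identity
is first proved after multiplication by `⨂ R_i`, which is injective and can be cancelled. This
replaces a joint spectral theorem for unbounded operators.

Rank part (`cpRank_le_iff`, `eRank_le_iff`, `ModeStable.isSumOf_sum`): each of the three ranks is
bounded by `r` exactly when the tensor is a sum of at most `r` terms from a family that is stable
under scalars and single-mode operators. -/

open Filter Asymptotics in
-- In Euler's limit formula the quotient `|Γ(a + iy)| / Γ(a)` is a product of factors `(a + j) / |a
-- + j + iy|`, each increasing in `a`; compare with `a = 1`. This reduces decay on the line `Re = a`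
-- to the line `Re = 1`, where the reflection formula gives the modulus exactly.
theorem norm_Gamma_add_mul_I_le_mul {a : ℝ} (ha₀ : 0 < a) (ha₁ : a ≤ 1) (y : ℝ) :
    ‖Complex.Gamma (a + y * Complex.I)‖ ≤
      Real.Gamma a * ‖Complex.Gamma (1 + y * Complex.I)‖ := by
  have key : ∀ n : ℕ, n ≠ 0 → ‖Complex.GammaSeq (a + y * Complex.I) n‖ * Real.GammaSeq 1 n ≤
      Real.GammaSeq a n * ‖Complex.GammaSeq (1 + y * Complex.I) n‖ := by
    intro n hn
    have hnorm : ∀ b : ℝ, ‖Complex.GammaSeq (b + y * Complex.I) n‖ =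
        (n : ℝ) ^ b * n.factorial / ∏ j ∈ Finset.range (n + 1), ‖((b + j : ℝ) : ℂ) + y * Complex.I‖ := by
      intro b
      rw [Complex.GammaSeq, norm_div, norm_mul, norm_prod,
        Complex.norm_natCast_cpow_of_pos (Nat.pos_of_ne_zero hn)]
      congr 1
      · simp
      · refine Finset.prod_congr rfl fun j _ => ?_
        congr 1
        push_cast
        ring
    have h1 := hnorm 1
    rw [Complex.ofReal_one] at h1
    rw [hnorm a, h1, Real.GammaSeq, Real.GammaSeq]
    have hpos : ∀ b : ℝ, 0 < b → ∀ j : ℕ, 0 < ‖((b + j : ℝ) : ℂ) + y * Complex.I‖ := by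
      intro b hb j
      refine norm_pos_iff.2 fun h => ?_
      have := congrArg Complex.re h
      simp at this
      linarith [(j.cast_nonneg : (0 : ℝ) ≤ j)]
    have hprod : (∏ j ∈ Finset.range (n + 1), (a + j)) *
          ∏ j ∈ Finset.range (n + 1), ‖(((1 : ℝ) + j : ℝ) : ℂ) + y * Complex.I‖ ≤
        (∏ j ∈ Finset.range (n + 1), ((1 : ℝ) + j)) *
          ∏ j ∈ Finset.range (n + 1), ‖((a + j : ℝ) : ℂ) + y * Complex.I‖ := by
      rw [← Finset.prod_mul_distrib, ← Finset.prod_mul_distrib]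
      refine Finset.prod_le_prod (fun j _ => by positivity) fun j _ => ?_
      rw [Complex.norm_add_mul_I, Complex.norm_add_mul_I]
      have hj : (0 : ℝ) ≤ j := j.cast_nonneg
      refine (sq_le_sq₀ (by positivity) (by positivity)).1 ?_
      rw [mul_pow, mul_pow, Real.sq_sqrt (by positivity), Real.sq_sqrt (by positivity)]
      have : (a + j) ^ 2 ≤ (1 + j) ^ 2 := by gcongr
      nlinarith [sq_nonneg y]
    have hA : 0 < ∏ j ∈ Finset.range (n + 1), (a + j) := Finset.prod_pos fun j _ => by positivity
    have hB : 0 < ∏ j ∈ Finset.range (n + 1), ((1 : ℝ) + j) :=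
      Finset.prod_pos fun j _ => by positivity
    have hC := Finset.prod_pos fun j (_ : j ∈ Finset.range (n + 1)) => hpos a ha₀ j
    have hD := Finset.prod_pos fun j (_ : j ∈ Finset.range (n + 1)) => hpos 1 one_pos j
    rw [div_mul_div_comm, div_mul_div_comm, div_le_div_iff₀ (by positivity) (by positivity)]
    have : 0 ≤ (n : ℝ) ^ a * n.factorial * ((n : ℝ) ^ (1 : ℝ) * n.factorial) := by positivity
    nlinarith [mul_le_mul_of_nonneg_left hprod this]
  have t1 := (Complex.GammaSeq_tendsto_Gamma (a + y * Complex.I)).norm.mul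
    (Real.GammaSeq_tendsto_Gamma 1)
  have t2 := (Real.GammaSeq_tendsto_Gamma a).mul
    (Complex.GammaSeq_tendsto_Gamma (1 + y * Complex.I)).norm
  rw [Real.Gamma_one, mul_one] at t1
  exact le_of_tendsto_of_tendsto t1 t2 ((eventually_ne_atTop 0).mono key)

/-- By reflection the left side equals `x / sinh x` with `x = π|y|`. Writing `sinh x = 2 sinh (x/2)
cosh (x/2) ≥ x exp (x/2) / 2` gives up half of the exponential rate to absorb the factor `x`. -/
theorem norm_Gamma_one_add_mul_I_sq_le (y : ℝ) :
    ‖Complex.Gamma (1 + y * Complex.I)‖ ^ 2 ≤ 2 * Real.exp (-(Real.pi * |y| / 2)) := by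
  rcases eq_or_ne y 0 with rfl | hy
  · simp
  have hyI : (y : ℂ) * Complex.I ≠ 0 := by simp [hy]
  have h1 : ((‖Complex.Gamma (1 + y * Complex.I)‖ ^ 2 : ℝ) : ℂ) =
      ((Real.pi * y / Real.sinh (Real.pi * y) : ℝ) : ℂ) := by
    push_cast
    rw [← Complex.mul_conj', ← Complex.Gamma_conj]
    have : (starRingEnd ℂ) (1 + y * Complex.I) = 1 - y * Complex.I := by simp [sub_eq_add_neg]
    rw [this, add_comm, Complex.Gamma_add_one _ hyI, mul_assoc, Complex.Gamma_mul_Gamma_one_sub,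
      ← mul_assoc (Real.pi : ℂ), Complex.sin_mul_I]
    have hs : Complex.sinh (Real.pi * y) ≠ 0 := by
      rw [← Complex.ofReal_mul, ← Complex.ofReal_sinh, Complex.ofReal_ne_zero, Ne,
        Real.sinh_eq_zero]
      positivity
    field_simp
  rw [Complex.ofReal_inj.1 h1]
  have h2 : Real.pi * y / Real.sinh (Real.pi * y) =
      (Real.pi * |y|) / Real.sinh (Real.pi * |y|) := by
    rcases abs_cases y with ⟨h, _⟩ | ⟨h, _⟩ <;> rw [h]
    rw [mul_neg, Real.sinh_neg, neg_div_neg_eq]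
  rw [h2]
  have hx : 0 < Real.pi * |y| := by positivity
  generalize Real.pi * |y| = x at hx
  rw [div_le_iff₀ (Real.sinh_pos_iff.2 hx)]
  have h3 : Real.sinh x = 2 * Real.sinh (x / 2) * Real.cosh (x / 2) := by
    rw [← Real.sinh_two_mul]; congr 1; ring
  have h4 : x / 2 ≤ Real.sinh (x / 2) := Real.self_le_sinh_iff.2 (by positivity)
  have h5 : Real.exp (x / 2) / 2 ≤ Real.cosh (x / 2) := by
    rw [Real.cosh_eq]; have := Real.exp_pos (-(x / 2)); linarith
  have h6 : Real.exp (-(x / 2)) * Real.exp (x / 2) = 1 := by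
    rw [← Real.exp_add]; simp
  rw [h3]
  have h7 : x / 2 * (Real.exp (x / 2) / 2) ≤ Real.sinh (x / 2) * Real.cosh (x / 2) := by
    gcongr
  calc x = 2 * Real.exp (-(x / 2)) * (2 * (x / 2 * (Real.exp (x / 2) / 2))) := by
        linear_combination (-x) * h6
    _ ≤ 2 * Real.exp (-(x / 2)) * (2 * (Real.sinh (x / 2) * Real.cosh (x / 2))) := by gcongr
    _ = _ := by ring

theorem norm_Gamma_add_mul_I_le {a : ℝ} (ha₀ : 0 < a) (ha₁ : a ≤ 1) (y : ℝ) :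
    ‖Complex.Gamma (a + y * Complex.I)‖ ≤
      2 * Real.Gamma a * Real.exp (-(Real.pi / 4 * |y|)) := by
  have h1 := norm_Gamma_add_mul_I_le_mul ha₀ ha₁ y
  have h2 : ‖Complex.Gamma (1 + y * Complex.I)‖ ≤ 2 * Real.exp (-(Real.pi / 4 * |y|)) := by
    refine (sq_le_sq₀ (by positivity) (by positivity)).1 ?_
    refine (norm_Gamma_one_add_mul_I_sq_le y).trans ?_
    rw [mul_pow, ← Real.exp_nat_mul]
    have : ((2 : ℕ) : ℝ) * -(Real.pi / 4 * |y|) = -(Real.pi * |y| / 2) := by push_cast; ring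
    rw [this]
    nlinarith [Real.exp_pos (-(Real.pi * |y| / 2))]
  calc _ ≤ _ := h1
    _ ≤ Real.Gamma a * (2 * Real.exp (-(Real.pi / 4 * |y|))) := by
        have := Real.Gamma_pos_of_pos ha₀
        gcongr
    _ = _ := by ring

/-- Outside the window `0, …, N - 1` there remain two geometric tails. It serves twice: for the dual
series in Poisson summation, with a window of one term, and for truncating the quadrature sum. -/
theorem norm_tsum_int_sub_sum_range_le {G : ℤ → ℂ} {E c : ℝ} (hc : 0 < c) (N : ℕ)
    (h₁ : ∀ k : ℕ, ‖G (N + k)‖ ≤ E * Real.exp (-(c * k)))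
    (h₂ : ∀ k : ℕ, ‖G (-(k + 1))‖ ≤ E * Real.exp (-(c * k))) :
    Summable G ∧ ‖∑' n, G n - ∑ k ∈ Finset.range N, G k‖ ≤ 2 * E * (1 + 1 / c) := by
  have hgeo : HasSum (fun k : ℕ => E * Real.exp (-(c * k))) (E * (1 - Real.exp (-c))⁻¹) := by
    refine HasSum.mul_left E ?_
    have := hasSum_geometric_of_lt_one (Real.exp_pos (-c)).le (by simpa using hc)
    have h : (fun k : ℕ => Real.exp (-(c * k))) = fun k : ℕ => Real.exp (-c) ^ k :=
      funext fun k => by rw [← Real.exp_nat_mul, mul_neg, mul_comm]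
    rwa [h]
  have s₁ : Summable fun k : ℕ => G (N + k) := hgeo.summable.of_norm_bounded h₁
  have s₂ : Summable fun k : ℕ => G (-(k + 1)) := hgeo.summable.of_norm_bounded h₂
  have s₃ : Summable fun k : ℕ => G k := by
    rw [← summable_nat_add_iff N]
    refine s₁.congr fun k => ?_
    rw [add_comm, Nat.cast_add]
  have hsum := s₃.hasSum.of_nat_of_neg_add_one s₂.hasSum
  refine ⟨hsum.summable, ?_⟩
  have e₁ := s₃.sum_add_tsum_nat_add N
  have e₂ : ∑' k : ℕ, G ((k + N : ℕ) : ℤ) = ∑' k : ℕ, G (N + k) :=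
    tsum_congr fun k => by congr 1; push_cast; ring
  rw [hsum.tsum_eq, ← e₁, e₂]
  have b₁ := tsum_of_norm_bounded hgeo h₁
  have b₂ := tsum_of_norm_bounded hgeo h₂
  have hE : 0 ≤ E := by
    have := (norm_nonneg _).trans (h₂ 0)
    simpa using this
  have hb : (1 - Real.exp (-c))⁻¹ ≤ 1 + 1 / c := by
    have h3 : Real.exp (-c) * (1 + c) ≤ 1 := by
      calc Real.exp (-c) * (1 + c) ≤ Real.exp (-c) * Real.exp c := by
            gcongr; linarith [Real.add_one_le_exp c]
        _ = 1 := by rw [← Real.exp_add]; simp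
    have h4 : 0 < 1 - Real.exp (-c) := by
      have : Real.exp (-c) < 1 := by simpa using hc
      linarith
    rw [inv_le_iff_one_le_mul₀ h4]
    have : (1 + 1 / c) = (1 + c) / c := by field_simp; ring
    rw [this, div_mul_eq_mul_div, le_div_iff₀ hc]
    nlinarith
  calc ‖_‖ = ‖(∑' k : ℕ, G (N + k)) + ∑' k : ℕ, G (-(k + 1))‖ := by congr 1; ring
    _ ≤ E * (1 - Real.exp (-c))⁻¹ + E * (1 - Real.exp (-c))⁻¹ :=
        (norm_add_le _ _).trans (add_le_add b₁ b₂)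
    _ = 2 * E * (1 - Real.exp (-c))⁻¹ := by ring
    _ ≤ _ := by gcongr


/-! ### Trapezoidal rule for the Gamma integral via Poisson summation -/

open scoped FourierTransform in
-- The substitution `t = exp (-h x)` turns this Fourier transform into the Mellin transform of `exp
-- (-l t)` at `a + 2πiw / h`, which is a Gamma integral.
theorem fourier_exp_neg_mul_exp {a h l : ℝ} (ha : 0 < a) (hh : 0 < h) (hl : 0 < l) (w : ℝ) :
    𝓕 (fun x : ℝ => ((Real.exp (-(a * h * x)) * Real.exp (-(l * Real.exp (-(h * x)))) : ℝ) : ℂ)) w =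
      (h⁻¹ : ℝ) * ((1 / (l : ℂ)) ^ ((a : ℂ) + (2 * Real.pi * w / h : ℝ) * Complex.I) *
        Complex.Gamma (a + (2 * Real.pi * w / h : ℝ) * Complex.I)) := by
  set s : ℂ := ((a * h : ℝ) : ℂ) + (2 * Real.pi * w : ℝ) * Complex.I with hs
  have hre : s.re = a * h := by simp [hs]
  have him : s.im = 2 * Real.pi * w := by simp [hs]
  have hdiv : s / (h : ℂ) = (a : ℂ) + (2 * Real.pi * w / h : ℝ) * Complex.I := by
    have : (h : ℂ) ≠ 0 := by exact_mod_cast hh.ne'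
    rw [hs]
    push_cast
    field_simp
  have h1 := mellin_eq_fourier (fun t : ℝ => Complex.exp (-(l * (t ^ h : ℝ)))) (s := s)
  have h2 := mellin_comp_rpow (fun t : ℝ => Complex.exp (-(l * t))) s h
  have h3 : mellin (fun t : ℝ => Complex.exp (-(l * t))) (s / h) =
      (1 / (l : ℂ)) ^ (s / h) * Complex.Gamma (s / h) := by
    rw [mellin]
    refine Complex.integral_cpow_mul_exp_neg_mul_Ioi ?_ hl
    rw [hdiv]
    simpa using ha
  rw [him, mul_div_cancel_left₀ _ (by positivity)] at h1
  rw [← hdiv, ← Complex.real_smul, ← h3]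
  rw [abs_of_pos hh] at h2
  rw [← h2, h1, hre]
  refine congrArg (fun f : ℝ → ℂ => 𝓕 f w) (funext fun x => ?_)
  rw [← Real.exp_mul, Complex.real_smul]
  push_cast
  congr 2 <;> ring_nf

open Filter Asymptotics in
theorem exp_neg_mul_abs_isBigO {c : ℝ} (hc : 0 < c) :
    (fun x : ℝ => Real.exp (-(c * |x|))) =O[cocompact ℝ] fun x : ℝ => |x| ^ (-(2 : ℝ)) := by
  refine IsBigO.of_bound (2 / c ^ 2) ?_
  filter_upwards [(isCompact_singleton (x := (0 : ℝ))).compl_mem_cocompact] with x hx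
  have hx : 0 < |x| := abs_pos.2 hx
  rw [Real.norm_of_nonneg (Real.exp_pos _).le, Real.norm_of_nonneg (by positivity),
    Real.rpow_neg hx.le, Real.rpow_two, ← div_eq_mul_inv, div_div, Real.exp_neg,
    inv_le_comm₀ (Real.exp_pos _) (by positivity), inv_div]
  have := Real.quadratic_le_exp_of_nonneg (x := c * |x|) (by positivity)
  nlinarith [mul_pos hc hx]

theorem exp_mul_exp_le {a h l : ℝ} (ha₁ : a ≤ 1) (hh : 0 < h) (hl : 1 ≤ l) (x : ℝ) :
    Real.exp (-(a * h * x)) * Real.exp (-(l * Real.exp (-(h * x)))) ≤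
      Real.exp (-(a * h * |x|)) := by
  rw [← Real.exp_add, Real.exp_le_exp]
  rcases le_total 0 x with hx | hx
  · rw [abs_of_nonneg hx]
    have : 0 ≤ l * Real.exp (-(h * x)) := by positivity
    linarith
  · rw [abs_of_nonpos hx]
    have hy : 0 ≤ -(h * x) := by nlinarith
    have h1 := Real.quadratic_le_exp_of_nonneg hy
    -- With `y = -(h x) ≥ 0`, the bound `2y ≤ exp y` lets the double exponential beat the growth `a
    -- y ≤ y` and leave decay at rate at least `a`.
    have h2 : -(h * x) * 2 ≤ Real.exp (-(h * x)) := by nlinarith [sq_nonneg (-(h * x) - 1)]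
    have h3 : Real.exp (-(h * x)) ≤ l * Real.exp (-(h * x)) :=
      le_mul_of_one_le_left (Real.exp_pos _).le hl
    have h4 : a * -(h * x) ≤ 1 * -(h * x) := by gcongr
    linarith

open scoped FourierTransform in
-- The zero frequency of the Poisson dual series is the integral itself, so the error is the sum
-- over the other frequencies. It is uniform in `l ≥ 1` because `|l ^ (-(a + iy))| ≤ 1`.
theorem norm_trapezoid_sub_le {a h l : ℝ} (ha₀ : 0 < a) (ha₁ : a ≤ 1) (hh : 0 < h) (hl : 1 ≤ l) :
    ‖(h : ℂ) * ∑' n : ℤ,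
        ((Real.exp (-(a * h * n)) * Real.exp (-(l * Real.exp (-(h * n)))) : ℝ) : ℂ) -
      ((l ^ (-a) * Real.Gamma a : ℝ) : ℂ)‖ ≤
      4 * Real.Gamma a * (1 + 2 * h / Real.pi ^ 2) * Real.exp (-(Real.pi ^ 2 / (2 * h))) := by
  set F : ℝ → ℂ := fun x =>
    ((Real.exp (-(a * h * x)) * Real.exp (-(l * Real.exp (-(h * x)))) : ℝ) : ℂ) with hF
  have hl₀ : 0 < l := one_pos.trans_le hl
  have hG : 0 < Real.Gamma a := Real.Gamma_pos_of_pos ha₀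
  have hfour := fourier_exp_neg_mul_exp ha₀ hh hl₀
  rw [← hF] at hfour
  have hbound : ∀ w : ℝ, ‖(h : ℂ) * 𝓕 F w‖ ≤
      2 * Real.Gamma a * Real.exp (-(Real.pi ^ 2 / (2 * h) * |w|)) := by
    intro w
    rw [hfour, ← mul_assoc, ← Complex.ofReal_mul, mul_inv_cancel₀ hh.ne', Complex.ofReal_one,
      one_mul, norm_mul]
    have h1 : ‖(1 / (l : ℂ)) ^ ((a : ℂ) + (2 * Real.pi * w / h : ℝ) * Complex.I)‖ ≤ 1 := by
      rw [one_div, ← Complex.ofReal_inv, Complex.norm_cpow_eq_rpow_re_of_pos (by positivity)]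
      refine Real.rpow_le_one (by positivity) (inv_le_one_of_one_le₀ hl) ?_
      simpa using ha₀.le
    have h2 := norm_Gamma_add_mul_I_le ha₀ ha₁ (2 * Real.pi * w / h)
    have h3 : Real.pi / 4 * |2 * Real.pi * w / h| = Real.pi ^ 2 / (2 * h) * |w| := by
      rw [abs_div, abs_mul, abs_of_pos hh, abs_of_pos Real.two_pi_pos]
      field_simp
      ring
    rw [h3] at h2
    exact (mul_le_of_le_one_left (norm_nonneg _) h1).trans h2
  have hc : 0 < Real.pi ^ 2 / (2 * h) := by positivity
  have hFbig : F =O[Filter.cocompact ℝ] fun x : ℝ => |x| ^ (-(2 : ℝ)) := by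
    refine (Asymptotics.IsBigO.of_bound 1 (.of_forall fun x => ?_)).trans
      (exp_neg_mul_abs_isBigO (mul_pos ha₀ hh))
    rw [one_mul, Real.norm_of_nonneg (Real.exp_pos _).le, Complex.norm_real,
      Real.norm_of_nonneg (by positivity)]
    exact exp_mul_exp_le ha₁ hh hl x
  obtain ⟨hsum, hle⟩ := norm_tsum_int_sub_sum_range_le (G := fun n : ℤ => (h : ℂ) * 𝓕 F n)
    (E := 2 * Real.Gamma a * Real.exp (-(Real.pi ^ 2 / (2 * h)))) hc 1
    (fun k => by
      refine (hbound _).trans_eq ?_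
      rw [mul_assoc (2 * Real.Gamma a), ← Real.exp_add]
      push_cast
      rw [abs_of_nonneg (by positivity)]
      ring_nf)
    (fun k => by
      refine (hbound _).trans_eq ?_
      rw [mul_assoc (2 * Real.Gamma a), ← Real.exp_add]
      push_cast
      rw [abs_neg, abs_of_nonneg (by positivity)]
      ring_nf)
  have hsum' : Summable fun n : ℤ => 𝓕 F n :=
    (summable_mul_left_iff (by exact_mod_cast hh.ne')).1 hsum
  have hpois := Real.tsum_eq_tsum_fourier_of_rpow_decay_of_summable (f := F)
    (by fun_prop) one_lt_two hFbig hsum' 0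
  simp only [zero_add, QuotientAddGroup.mk_zero, fourier_eval_zero, mul_one] at hpois
  have h0 : (h : ℂ) * 𝓕 F 0 = ((l ^ (-a) * Real.Gamma a : ℝ) : ℂ) := by
    rw [hfour, ← mul_assoc, ← Complex.ofReal_mul, mul_inv_cancel₀ hh.ne', Complex.ofReal_one,
      one_mul]
    simp only [mul_zero, zero_div, Complex.ofReal_zero, zero_mul, add_zero]
    rw [Complex.ofReal_mul, Complex.Gamma_ofReal, one_div, ← Complex.ofReal_inv,
      ← Complex.ofReal_cpow (by positivity), Real.inv_rpow hl₀.le, Real.rpow_neg hl₀.le]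
  rw [hpois, ← tsum_mul_left, ← h0]
  simp only [Finset.range_one, Finset.sum_singleton, Nat.cast_zero, Int.cast_zero] at hle
  refine hle.trans_eq ?_
  field_simp
  ring

/-- Negative powers are approximated on `[1, ∞)` by sums of `N` decaying exponentials, with an
error that is uniform and root-exponentially small in `N`. -/
theorem exists_expSum_approx_rpow_neg {a : ℝ} (ha₀ : 0 < a) (ha₁ : a ≤ 1) :
    ∃ K : ℝ, 0 < K ∧ ∀ N : ℕ, ∃ w t : ℕ → ℝ, (∀ k, 0 < t k) ∧ ∀ l : ℝ, 1 ≤ l →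
      |l ^ (-a) - ∑ k ∈ Finset.range N, w k * Real.exp (-(t k * l))| ≤
        K * Real.exp (-(Real.pi / 2) * Real.sqrt (a * N)) := by
  have hG : 0 < Real.Gamma a := Real.Gamma_pos_of_pos ha₀
  have hsa : 0 < Real.sqrt a := Real.sqrt_pos.2 ha₀
  set H : ℝ := Real.pi / Real.sqrt a with hH
  have hH₀ : 0 < H := by positivity
  -- `H` is the step for `N = 1`, hence the largest one. The first two terms come from
  -- discretization and truncation; the final `+ 1` covers `N = 0`, where the sum is empty and the
  -- step is undefined.
  refine ⟨4 * (1 + 2 * H / Real.pi ^ 2) + 2 * (H + 1 / a) / Real.Gamma a + 1, by positivity,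
    fun N => ?_⟩
  rcases Nat.eq_zero_or_pos N with rfl | hN
  · refine ⟨0, 1, fun _ => one_pos, fun l hl => ?_⟩
    simp only [Finset.range_zero, Finset.sum_empty, sub_zero, Nat.cast_zero, mul_zero,
      Real.sqrt_zero, Real.exp_zero, mul_one]
    rw [abs_of_nonneg (Real.rpow_nonneg (by linarith) _)]
    have h1 : l ^ (-a) ≤ 1 := Real.rpow_le_one_of_one_le_of_nonpos hl (by linarith)
    have h2 : 0 ≤ 4 * (1 + 2 * H / Real.pi ^ 2) + 2 * (H + 1 / a) / Real.Gamma a := by positivity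
    linarith
  have hN' : (1 : ℝ) ≤ N := by exact_mod_cast hN
  have hsN : 0 < Real.sqrt (a * N) := Real.sqrt_pos.2 (by positivity)
  set h : ℝ := Real.pi / Real.sqrt (a * N) with hh
  have hh₀ : 0 < h := by positivity
  have hhH : h ≤ H := by
    rw [hh, hH]
    gcongr
    nlinarith
  -- The nodes are `-m, …, N - 1 - m`. For either parity the first omitted node on each side has
  -- absolute value at least `N / 2`.
  set m : ℕ := N / 2 with hm
  have hm₁ : (N : ℝ) / 2 ≤ m + 1 := by
    have : N ≤ 2 * (m + 1) := by omega
    have : (N : ℝ) ≤ 2 * (m + 1) := by exact_mod_cast this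
    linarith
  have hm₂ : (m : ℝ) ≤ N / 2 := by
    have : 2 * m ≤ N := by omega
    have : 2 * (m : ℝ) ≤ N := by exact_mod_cast this
    linarith
  refine ⟨fun k => h * Real.exp (-(a * h * (k - m))) / Real.Gamma a,
    fun k => Real.exp (-(h * (k - m))), fun k => Real.exp_pos _, fun l hl => ?_⟩
  set F : ℤ → ℂ := fun n =>
    ((Real.exp (-(a * h * n)) * Real.exp (-(l * Real.exp (-(h * n)))) : ℝ) : ℂ) with hF
  set e : ℝ := Real.exp (-(Real.pi / 2) * Real.sqrt (a * N)) with he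
  have hdisc := norm_trapezoid_sub_le ha₀ ha₁ hh₀ hl
  have he₁ : Real.exp (-(Real.pi ^ 2 / (2 * h))) = e := by
    rw [he, hh]
    congr 1
    field_simp
  have he₂ : Real.exp (-(a * h * (N / 2))) = e := by
    rw [he, hh]
    congr 1
    have := Real.mul_self_sqrt (show 0 ≤ a * N by positivity)
    field_simp
    linear_combination this
  have hFle : ∀ n : ℤ, ‖F n‖ ≤ Real.exp (-(a * h * |(n : ℝ)|)) := fun n => by
    rw [Complex.norm_real, Real.norm_of_nonneg (by positivity)]
    exact exp_mul_exp_le ha₁ hh₀ hl n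
  obtain ⟨-, htrunc⟩ := norm_tsum_int_sub_sum_range_le
    (G := fun n : ℤ => (h : ℂ) * F (n - m)) (E := h * e) (mul_pos ha₀ hh₀) N
    (fun k => by
      rw [norm_mul, Complex.norm_real, Real.norm_of_nonneg hh₀.le, mul_assoc h]
      refine mul_le_mul_of_nonneg_left ((hFle _).trans ?_) hh₀.le
      rw [← he₂, ← Real.exp_add, Real.exp_le_exp]
      push_cast
      have : (N : ℝ) / 2 + k ≤ |(N : ℝ) + k - m| := le_abs.2 (Or.inl (by linarith))
      nlinarith [mul_pos ha₀ hh₀])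
    (fun k => by
      rw [norm_mul, Complex.norm_real, Real.norm_of_nonneg hh₀.le, mul_assoc h]
      refine mul_le_mul_of_nonneg_left ((hFle _).trans ?_) hh₀.le
      rw [← he₂, ← Real.exp_add, Real.exp_le_exp]
      push_cast
      have : (N : ℝ) / 2 + k ≤ |-((k : ℝ) + 1) - m| := le_abs.2 (Or.inr (by linarith))
      nlinarith [mul_pos ha₀ hh₀])
  have hshift : ∑' n : ℤ, F (n - m) = ∑' n, F n := (Equiv.subRight (m : ℤ)).tsum_eq F
  rw [tsum_mul_left, hshift] at htrunc
  have hcomb : ‖((l ^ (-a) * Real.Gamma a : ℝ) : ℂ) -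
      ∑ k ∈ Finset.range N, (h : ℂ) * F ((k : ℤ) - m)‖ ≤
      4 * Real.Gamma a * (1 + 2 * h / Real.pi ^ 2) * e + 2 * (h * e) * (1 + 1 / (a * h)) := by
    rw [he₁] at hdisc
    refine (norm_sub_le_norm_sub_add_norm_sub _ ((h : ℂ) * ∑' n, F n) _).trans ?_
    rw [norm_sub_rev]
    exact add_le_add hdisc htrunc
  have hreal : l ^ (-a) - ∑ k ∈ Finset.range N,
      h * Real.exp (-(a * h * (k - m))) / Real.Gamma a * Real.exp (-(Real.exp (-(h * (k - m))) * l))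
      = (l ^ (-a) * Real.Gamma a - ∑ k ∈ Finset.range N, h *
        (Real.exp (-(a * h * ((k : ℝ) - m))) * Real.exp (-(l * Real.exp (-(h * ((k : ℝ) - m)))))))
        / Real.Gamma a := by
    rw [sub_div, mul_div_cancel_right₀ _ hG.ne', Finset.sum_div]
    congr 1
    refine Finset.sum_congr rfl fun k _ => ?_
    rw [mul_comm l]
    ring
  have hcast : ((l ^ (-a) * Real.Gamma a : ℝ) : ℂ) -
      ∑ k ∈ Finset.range N, (h : ℂ) * F ((k : ℤ) - m) =
      ((l ^ (-a) * Real.Gamma a - ∑ k ∈ Finset.range N, h *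
        (Real.exp (-(a * h * ((k : ℝ) - m))) *
          Real.exp (-(l * Real.exp (-(h * ((k : ℝ) - m)))))) : ℝ) : ℂ) := by
    simp only [hF]
    push_cast
    rfl
  rw [hcast, Complex.norm_real, Real.norm_eq_abs] at hcomb
  rw [hreal, abs_div, abs_of_pos hG, div_le_iff₀ hG]
  refine hcomb.trans ?_
  have he₀ : 0 < e := Real.exp_pos _
  have h1 : 2 * (h * e) * (1 + 1 / (a * h)) = 2 * (h + 1 / a) * e := by field_simp
  rw [h1]
  calc _ ≤ 4 * Real.Gamma a * (1 + 2 * H / Real.pi ^ 2) * e + 2 * (H + 1 / a) * e := by gcongr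
    _ ≤ 4 * Real.Gamma a * (1 + 2 * H / Real.pi ^ 2) * e + 2 * (H + 1 / a) * e +
        e * Real.Gamma a := by nlinarith [mul_pos he₀ hG]
    _ = _ := by field_simp

/-! ### Functional calculus of commuting elements -/

theorem apply_cfc_of_character {A : Type*} [CommCStarAlgebra A]
    (χ : WeakDual.characterSpace ℂ A) (f : ℝ → ℝ) (hf : Continuous f) {a : A}
    (ha : IsSelfAdjoint a) : χ (cfc f a) = (f (χ a).re : ℂ) := by
  have hχ : IsSelfAdjoint (χ a) := ha.map χ
  have h1 : χ (cfc f a) = cfc f (χ a) :=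
    StarAlgHomClass.map_cfc (S := ℂ) χ f a hf.continuousOn (map_continuous χ) ha hχ
  have h2 : χ a = algebraMap ℝ ℂ (χ a).re := (Complex.conj_eq_iff_re.1 hχ).symm
  rw [h1]
  conv_lhs => rw [h2]
  exact cfc_algebraMap _ _

theorem eq_zero_of_forall_character {A : Type*} [CommCStarAlgebra A] {a : A}
    (h : ∀ χ : WeakDual.characterSpace ℂ A, χ a = 0) : a = 0 := by
  refine (gelfandTransform_bijective A).1 ?_
  ext χ
  simpa using h χ

theorem continuous_expNegInvGlue_div (t : ℝ) : Continuous fun x => expNegInvGlue (x / t) :=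
  (expNegInvGlue.contDiff (n := 0)).continuous.comp (continuous_id.div_const t)

theorem expNegInvGlue_of_pos {x : ℝ} (hx : 0 < x) : expNegInvGlue x = Real.exp (-x⁻¹) := by
  simp [expNegInvGlue, hx.not_ge]

/-- If `b⁻¹ = ∑ (r_j⁻¹ - 1)`, then `∏ exp (-t (r_j⁻¹ - 1)) = exp (-t b⁻¹)`. -/
theorem prod_expNegInvGlue {d : ℕ} {r : Fin d → ℝ} {b t : ℝ} (ht : 0 < t)
    (hr₀ : ∀ i, 0 ≤ r i) (hr₁ : ∀ i, r i ≤ 1) (hp : ∏ i, r i ≠ 0)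
    (hb : b * ∑ j, ∏ i, Function.update r j (1 - r j) i = ∏ i, r i) :
    0 < b ∧ ∏ i, Real.exp t * expNegInvGlue (r i / t) = expNegInvGlue (b / t) := by
  have hpos : ∀ i, 0 < r i := fun i =>
    (hr₀ i).lt_of_ne' (Finset.prod_ne_zero_iff.1 hp i (Finset.mem_univ i))
  have hpp : 0 < ∏ i, r i := Finset.prod_pos fun i _ => hpos i
  have hsum : ∑ j, ∏ i, Function.update r j (1 - r j) i = (∏ i, r i) * ∑ j, ((r j)⁻¹ - 1) := by
    rw [Finset.mul_sum]
    refine Finset.sum_congr rfl fun j _ => ?_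
    rw [Finset.prod_update_of_mem (Finset.mem_univ j), ← Finset.mul_prod_erase _ r (Finset.mem_univ j),
      Finset.sdiff_singleton_eq_erase]
    have := (hpos j).ne'
    field_simp
  rw [hsum] at hb
  have hb1 : b * ∑ j, ((r j)⁻¹ - 1) = 1 := by
    refine mul_left_cancel₀ hpp.ne' ?_
    linear_combination hb
  have hs : 0 ≤ ∑ j, ((r j)⁻¹ - 1) := Finset.sum_nonneg fun j _ => by
    have := (one_le_inv₀ (hpos j)).2 (hr₁ j)
    linarith
  have hb0 : 0 < b := by
    by_contra! h
    nlinarith [mul_nonneg (neg_nonneg.2 h) hs]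
  refine ⟨hb0, ?_⟩
  rw [expNegInvGlue_of_pos (by positivity)]
  have h1 : ∀ i, Real.exp t * expNegInvGlue (r i / t) = Real.exp (-(t * ((r i)⁻¹ - 1))) := by
    intro i
    rw [expNegInvGlue_of_pos (div_pos (hpos i) ht), ← Real.exp_add, inv_div]
    congr 1
    ring
  simp_rw [h1]
  rw [← Real.exp_sum, Finset.sum_neg_distrib, ← Finset.mul_sum, eq_inv_of_mul_eq_one_right hb1,
    inv_div, div_eq_mul_inv]

/-- By Gelfand duality it suffices to evaluate at characters. Either the factor `∏ r_i` vanishes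
there, or the scalar lemma `prod_expNegInvGlue` applies. The function `expNegInvGlue (x / t)` is the
continuous extension by `0` of `exp (-t / x)` from `x > 0`, so exponentials of unbounded operators
become continuous functions of bounded ones. -/
theorem prod_mul_cfc_eq_zero_of_comm {A : Type*} [CommCStarAlgebra A] {d : ℕ} {r : Fin d → A}
    {b : A} (hr : ∀ i, IsSelfAdjoint (r i)) (hb : IsSelfAdjoint b)
    (hspec : ∀ i, ∀ z ∈ spectrum ℂ (r i), 0 ≤ z.re ∧ z.re ≤ 1)
    (hrel : b * ∑ j, ∏ i, Function.update r j (1 - r j) i = ∏ i, r i) :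
    (∏ i, r i) * cfc (fun x : ℝ => min x 0) b = 0 ∧ ∀ t : ℝ, 0 < t → (∏ i, r i) *
      (∏ i, cfc (fun x : ℝ => Real.exp t * expNegInvGlue (x / t)) (r i) -
        cfc (fun x : ℝ => expNegInvGlue (x / t)) b) = 0 := by
  have hχ : ∀ χ : WeakDual.characterSpace ℂ A, χ (∏ i, r i) ≠ 0 → ∀ t : ℝ, 0 < t →
      0 < (χ b).re ∧ ∏ i, Real.exp t * expNegInvGlue ((χ (r i)).re / t) =
        expNegInvGlue ((χ b).re / t) := by
    intro χ hne t ht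
    have hre : ∀ a, IsSelfAdjoint a → χ a = ((χ a).re : ℂ) := fun a ha =>
      (Complex.conj_eq_iff_re.1 (ha.map χ)).symm
    have hb' := hre b hb
    have hprod : χ (∏ i, r i) = ((∏ i, (χ (r i)).re : ℝ) : ℂ) := by
      rw [map_prod, Complex.ofReal_prod]
      exact Finset.prod_congr rfl fun i _ => hre _ (hr i)
    refine prod_expNegInvGlue ht (fun i => (hspec i _ (AlgHom.apply_mem_spectrum χ (r i))).1)
      (fun i => (hspec i _ (AlgHom.apply_mem_spectrum χ (r i))).2) ?_ ?_
    · rw [hprod] at hne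
      exact_mod_cast hne
    · have h := congrArg χ hrel
      rw [map_mul, hprod, hb', map_sum] at h
      have h2 : ∀ j, χ (∏ i, Function.update r j (1 - r j) i) =
          ((∏ i, Function.update (fun i => (χ (r i)).re) j (1 - (χ (r j)).re) i : ℝ) : ℂ) := by
        intro j
        rw [map_prod, Complex.ofReal_prod]
        refine Finset.prod_congr rfl fun i _ => ?_
        rcases eq_or_ne i j with rfl | hij
        · simp only [Function.update_self, map_sub, map_one]
          rw [hre _ (hr i)]
          simp
        · simp only [Function.update_of_ne hij]
          exact hre _ (hr i)
      simp_rw [h2] at h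
      exact_mod_cast h
  constructor
  · refine eq_zero_of_forall_character fun χ => ?_
    rw [map_mul]
    by_cases h : χ (∏ i, r i) = 0
    · rw [h, zero_mul]
    · rw [apply_cfc_of_character χ _ (by fun_prop) hb, min_eq_right (hχ χ h 1 one_pos).1.le]
      simp
  · intro t ht
    refine eq_zero_of_forall_character fun χ => ?_
    rw [map_mul]
    by_cases h : χ (∏ i, r i) = 0
    · rw [h, zero_mul]
    · have h1 : ∀ i, χ (cfc (fun x : ℝ => Real.exp t * expNegInvGlue (x / t)) (r i)) =
          ((Real.exp t * expNegInvGlue ((χ (r i)).re / t) : ℝ) : ℂ) := fun i =>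
        apply_cfc_of_character χ _ (continuous_const.mul (continuous_expNegInvGlue_div t)) (hr i)
      rw [map_sub, apply_cfc_of_character χ _ (continuous_expNegInvGlue_div t) hb,
        ← (hχ χ h t ht).2, map_prod, map_prod, Complex.ofReal_prod, Finset.prod_congr rfl fun i _ => h1 i,
        sub_self, mul_zero]

/-- The commuting self-adjoint elements generate a commutative closed star subalgebra. The
functional calculus and the spectrum are the same computed there or in `A`, so the commutative case
transfers. -/
theorem prod_mul_cfc_eq_zero {A : Type*} [CStarAlgebra A] {d : ℕ} {r : Fin d → A}
    {b : A} (hr : ∀ i, IsSelfAdjoint (r i)) (hb : IsSelfAdjoint b)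
    (hrr : ∀ i j, Commute (r i) (r j)) (hbr : ∀ i, Commute b (r i))
    (hspec : ∀ i, ∀ z ∈ spectrum ℂ (r i), 0 ≤ z.re ∧ z.re ≤ 1)
    (hrel : b * ∑ j, (List.ofFn (Function.update r j (1 - r j))).prod = (List.ofFn r).prod) :
    (List.ofFn r).prod * cfc (fun x : ℝ => min x 0) b = 0 ∧ ∀ t : ℝ, 0 < t →
      (List.ofFn r).prod *
        ((List.ofFn fun i => cfc (fun x : ℝ => Real.exp t * expNegInvGlue (x / t)) (r i)).prod -
          cfc (fun x : ℝ => expNegInvGlue (x / t)) b) = 0 := by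
  set s : Set A := insert b (Set.range r) with hs
  have hstar : ∀ x ∈ s, star x = x := by
    rintro x (rfl | ⟨i, rfl⟩)
    exacts [hb, hr i]
  have hcomm : ∀ x ∈ s, ∀ y ∈ s, x * y = y * x := by
    rintro x (rfl | ⟨i, rfl⟩) y (rfl | ⟨j, rfl⟩)
    exacts [rfl, hbr j, (hbr i).symm, hrr i j]
  set S : StarSubalgebra ℂ A := (StarAlgebra.adjoin ℂ s).topologicalClosure with hS
  have hclosed : IsClosed (S : Set A) := StarSubalgebra.isClosed_topologicalClosure _
  have hadj : ∀ x y : StarAlgebra.adjoin ℂ s, x * y = y * x := by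
    have := StarAlgebra.isMulCommutative_adjoin ℂ hcomm fun x hx y hy => by
      rw [hstar y hy]; exact hcomm x hx y hy
    exact fun x y => mul_comm' x y
  let _ : CommCStarAlgebra S :=
    { StarSubalgebra.cstarAlgebra S with
      mul_comm := (StarSubalgebra.commRingTopologicalClosure _ hadj).mul_comm }
  have hsub : s ⊆ S := (StarAlgebra.subset_adjoin ℂ s).trans subset_closure
  set bS : S := ⟨b, hsub (Set.mem_insert _ _)⟩ with hb'
  set rS : Fin d → S := fun i => ⟨r i, hsub (Set.mem_insert_of_mem _ ⟨i, rfl⟩)⟩ with hr'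
  have hbs : IsSelfAdjoint bS := Subtype.ext hb
  have hrs : ∀ i, IsSelfAdjoint (rS i) := fun i => Subtype.ext (hr i)
  have hmap : ∀ (f : ℝ → ℝ) (_ : Continuous f) (x : S) (_ : IsSelfAdjoint x),
      ((cfc f x : S) : A) = cfc f (x : A) := fun f hf x hx =>
    StarAlgHomClass.map_cfc (S := ℂ) S.subtype f x hf.continuousOn continuous_subtype_val hx
      (hx.map S.subtype)
  have hlist : ∀ g : Fin d → S, ((∏ i, g i : S) : A) = (List.ofFn fun i => (g i : A)).prod := by
    intro g
    rw [← List.prod_ofFn]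
    exact (map_list_prod S.subtype _).trans (by rw [List.map_ofFn]; rfl)
  have hspec' : ∀ i, ∀ z ∈ spectrum ℂ (rS i), 0 ≤ z.re ∧ z.re ≤ 1 := fun i z hz =>
    hspec i z (by rwa [StarSubalgebra.spectrum_eq S (hS := hclosed)] at hz)
  have hupd : ∀ j, (fun i => ((Function.update rS j (1 - rS j) i : S) : A)) =
      Function.update r j (1 - r j) := by
    intro j
    funext i
    rcases eq_or_ne i j with rfl | hij
    · simp [hr']
    · simp [hr', Function.update_of_ne hij]
  have hrel' : bS * ∑ j, ∏ i, Function.update rS j (1 - rS j) i = ∏ i, rS i := by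
    refine Subtype.ext ?_
    rw [hlist, ← hrel]
    refine (map_mul S.subtype _ _).trans ?_
    rw [map_sum]
    congr 1
    refine Finset.sum_congr rfl fun j _ => ?_
    rw [← hupd j]
    exact hlist _
  obtain ⟨h1, h2⟩ := prod_mul_cfc_eq_zero_of_comm hrs hbs hspec' hrel'
  constructor
  · have h := congrArg S.subtype h1
    rw [map_mul, map_zero] at h
    rw [← hmap _ (by fun_prop) bS hbs]
    exact (hlist rS) ▸ h
  · intro t ht
    have h := congrArg S.subtype (h2 t ht)
    rw [map_mul, map_zero, map_sub] at h
    have e1 : ∀ i, cfc (fun x : ℝ => Real.exp t * expNegInvGlue (x / t)) (r i) =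
        ((cfc (fun x : ℝ => Real.exp t * expNegInvGlue (x / t)) (rS i) : S) : A) := fun i =>
      (hmap _ (continuous_const.mul (continuous_expNegInvGlue_div t)) _ (hrs i)).symm
    simp_rw [e1]
    rw [← hmap _ (continuous_expNegInvGlue_div t) bS hbs, ← hlist]
    exact (hlist rS) ▸ h

/-! ### The resolvent of a positive self-adjoint operator -/

section Resolvent

variable {H : Type u} [NormedAddCommGroup H] [InnerProductSpace ℂ H] [CompleteSpace H]

theorem IsSPD.re_inner_nonneg {A : H →ₗ.[ℂ] H} (hA : IsSPD A) (v : A.domain) :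
    0 ≤ (⟪A v, (v : H)⟫_ℂ).re := by
  by_cases h : (v : H) = 0
  · simp [h]
  · exact (hA.2 v h).le

theorem IsSPD.inner_symm {A : H →ₗ.[ℂ] H} (hA : IsSPD A) (v w : A.domain) :
    ⟪A v, (w : H)⟫_ℂ = ⟪(v : H), A w⟫_ℂ := by
  have h := LinearPMap.adjoint_isFormalAdjoint hA.1.dense_domain
  rw [LinearPMap.isSelfAdjoint_def.1 hA.1] at h
  exact h v w

theorem IsSPD.norm_sq_add_le {A : H →ₗ.[ℂ] H} (hA : IsSPD A) (v : A.domain) :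
    ‖(v : H)‖ ^ 2 + ‖A v‖ ^ 2 ≤ ‖(v : H) + A v‖ ^ 2 := by
  have h1 := norm_add_sq (𝕜 := ℂ) (A v) (v : H)
  have h2 := hA.re_inner_nonneg v
  rw [add_comm (v : H), h1]
  simp only [RCLike.re_to_complex]
  linarith

/-- Positivity bounds `1 + A` from below on the closed graph of `A`, so it is injective with closed
range; self-adjointness makes the range dense. -/
theorem IsSPD.exists_add_apply_eq {A : H →ₗ.[ℂ] H} (hA : IsSPD A) :
    ∃ R : H →L[ℂ] H, ∀ y, ∃ h : R y ∈ A.domain, A ⟨R y, h⟩ = y - R y := by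
  have hcl : IsClosed (A.graph : Set (H × H)) := hA.1.isClosed
  have : CompleteSpace A.graph := hcl.completeSpace_coe
  let L : A.graph →L[ℂ] H :=
    (ContinuousLinearMap.fst ℂ H H + ContinuousLinearMap.snd ℂ H H).comp A.graph.subtypeL
  have hL : ∀ x : A.graph, ‖x‖ ≤ ‖L x‖ := by
    rintro ⟨⟨v, w⟩, hx⟩
    obtain ⟨v', rfl, rfl⟩ := A.mem_graph_iff.1 hx
    have h := hA.norm_sq_add_le v'
    change max ‖(v' : H)‖ ‖A v'‖ ≤ ‖(v' : H) + A v'‖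
    refine max_le ?_ ?_ <;> refine (sq_le_sq₀ (norm_nonneg _) (norm_nonneg _)).1 ?_ <;>
      nlinarith [sq_nonneg ‖(v' : H)‖, sq_nonneg ‖A v'‖]
  have hanti : AntilipschitzWith 1 L :=
    AddMonoidHomClass.antilipschitz_of_bound L fun x => by simpa using hL x
  have hrange : IsClosed (L.range : Set H) := by
    rw [LinearMap.coe_range]
    exact hanti.isClosed_range L.uniformContinuous
  have htop : L.range = ⊤ := by
    have : CompleteSpace L.range := hrange.completeSpace_coe
    rw [← Submodule.orthogonal_eq_bot_iff, Submodule.eq_bot_iff]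
    intro y hy
    rw [Submodule.mem_orthogonal] at hy
    -- A vector `y` orthogonal to the range lies in the domain of the adjoint with `A* y = -y`. As
    -- `A* = A`, positivity forces `y = 0`.
    have hy' : ∀ v : A.domain, ⟪-y, (v : H)⟫_ℂ = ⟪y, A v⟫_ℂ := by
      intro v
      have h := hy (L ⟨(v, A v), A.mem_graph v⟩) ⟨_, rfl⟩
      have h' : ⟪(v : H) + A v, y⟫_ℂ = 0 := h
      rw [← inner_conj_symm, map_eq_zero, inner_add_right] at h'
      rw [inner_neg_left]
      linear_combination -h'
    have hmem : y ∈ A.adjoint.domain := LinearPMap.mem_adjoint_domain_of_exists y ⟨-y, hy'⟩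
    have hval := LinearPMap.adjoint_apply_eq hA.1.dense_domain ⟨y, hmem⟩ hy'
    have hgraph : (y, -y) ∈ A.adjoint.graph := by
      rw [← hval]
      exact LinearPMap.mem_graph _ ⟨y, hmem⟩
    rw [LinearPMap.isSelfAdjoint_def.1 hA.1] at hgraph
    obtain ⟨v, hv, hAv⟩ := A.mem_graph_iff.1 hgraph
    simp only at hv hAv
    have h := hA.re_inner_nonneg v
    rw [hAv, hv, inner_neg_left, Complex.neg_re,
      show (⟪y, y⟫_ℂ).re = ‖y‖ ^ 2 from inner_self_eq_norm_sq (𝕜 := ℂ) y] at h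
    by_contra hne
    have := norm_pos_iff.2 hne
    have h3 : (0 : ℝ) < ‖y‖ ^ 2 := by positivity
    linarith
  let e := ContinuousLinearEquiv.ofBijective L (LinearMap.ker_eq_bot.2 hanti.injective) htop
  refine ⟨(ContinuousLinearMap.fst ℂ H H).comp (A.graph.subtypeL.comp
    (e.symm : H →L[ℂ] A.graph)), fun y => ?_⟩
  have h1 : L (e.symm y) = y := e.apply_symm_apply y
  obtain ⟨v, hv, hAv⟩ := A.mem_graph_iff.1 (e.symm y).2
  have hadd : ((e.symm y : A.graph) : H × H).1 + ((e.symm y : A.graph) : H × H).2 = y := h1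
  have hmem : ((e.symm y : A.graph) : H × H).1 ∈ A.domain := hv ▸ v.2
  refine ⟨hmem, ?_⟩
  have h2 : (⟨((e.symm y : A.graph) : H × H).1, hmem⟩ : A.domain) = v := Subtype.ext hv.symm
  refine (congrArg A h2).trans ?_
  rw [hAv]
  exact eq_sub_of_add_eq' hadd

/-- `R` is the resolvent `(1 + A)⁻¹`. -/
structure IsResolvent (A : H →ₗ.[ℂ] H) (R : H →L[ℂ] H) : Prop where
  mem_domain : ∀ y, R y ∈ A.domain
  apply_eq : ∀ y, A ⟨R y, mem_domain y⟩ = y - R y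
  map_add_apply : ∀ v : A.domain, R (v + A v) = v
  isSelfAdjoint : IsSelfAdjoint R
  spectrum_re : ∀ z ∈ spectrum ℂ R, 0 ≤ z.re ∧ z.re ≤ 1

theorem IsSPD.exists_isResolvent {A : H →ₗ.[ℂ] H} (hA : IsSPD A) : ∃ R, IsResolvent A R := by
  obtain ⟨R, hR⟩ := hA.exists_add_apply_eq
  choose hmem hval using hR
  have hnorm : ‖R‖ ≤ 1 := by
    refine R.opNorm_le_bound zero_le_one fun y => ?_
    have h := hA.norm_sq_add_le ⟨R y, hmem y⟩
    rw [hval, add_sub_cancel] at h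
    rw [one_mul]
    refine (sq_le_sq₀ (norm_nonneg _) (norm_nonneg _)).1 ?_
    simp only at h
    nlinarith [sq_nonneg ‖y - R y‖]
  have hsa : IsSelfAdjoint R := by
    rw [ContinuousLinearMap.isSelfAdjoint_iff_isSymmetric]
    intro y z
    have h := hA.inner_symm ⟨R y, hmem y⟩ ⟨R z, hmem z⟩
    rw [hval, hval, inner_sub_left, inner_sub_right] at h
    simp only at h
    change ⟪R y, z⟫_ℂ = ⟪y, R z⟫_ℂ
    linear_combination -h
  have hpos : 0 ≤ R := by
    rw [ContinuousLinearMap.nonneg_iff_isPositive, ContinuousLinearMap.isPositive_def']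
    refine ⟨hsa, fun y => ?_⟩
    have h := hA.re_inner_nonneg ⟨R y, hmem y⟩
    rw [hval, inner_sub_left, Complex.sub_re,
      show (⟪R y, R y⟫_ℂ).re = ‖R y‖ ^ 2 from inner_self_eq_norm_sq (𝕜 := ℂ) (R y)] at h
    rw [ContinuousLinearMap.reApplyInnerSelf_apply, ← inner_re_symm]
    simp only [RCLike.re_to_complex]
    nlinarith [sq_nonneg ‖R y‖]
  refine ⟨R, hmem, hval, fun v => ?_, hsa, fun z hz => ?_⟩
  -- The operator `1 + A` kills `R (v + A v) - v`, and it is bounded below.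
  · have h := hA.norm_sq_add_le (⟨R (v + A v), hmem _⟩ - v)
    rw [LinearPMap.map_sub, hval, Submodule.coe_sub] at h
    simp only at h
    have h0 : R (v + A v) - (v : H) + ((v : H) + A v - R (v + A v) - A v) = 0 := by abel
    rw [h0, norm_zero] at h
    have h1 : ‖R (v + A v) - (v : H)‖ ^ 2 = 0 := by
      nlinarith [sq_nonneg ‖R (v + A v) - (v : H)‖, sq_nonneg ‖(v : H) + A v - R (v + A v) - A v‖]
    exact sub_eq_zero.1 (norm_eq_zero.1 (pow_eq_zero_iff two_ne_zero |>.1 h1))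
  · have hz' : z = (z.re : ℂ) := hsa.mem_spectrum_eq_re hz
    constructor
    · refine spectrum_nonneg_of_nonneg hpos ?_
      rw [← spectrum.preimage_algebraMap ℂ]
      exact hz' ▸ hz
    · have : ‖z‖ ≤ ‖R‖ * ‖(1 : H →L[ℂ] H)‖ := spectrum.norm_le_norm_mul_of_mem hz
      have h1 : ‖(1 : H →L[ℂ] H)‖ ≤ 1 := ContinuousLinearMap.norm_id_le
      calc z.re ≤ ‖z‖ := Complex.re_le_norm z
        _ ≤ ‖R‖ * ‖(1 : H →L[ℂ] H)‖ := this
        _ ≤ 1 * 1 := by gcongr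
        _ = 1 := one_mul 1

end Resolvent

/-! ### Operators acting on one factor of a product index set -/

section Ampliation

variable {κ a b : Type u}

theorem summable_norm_sq (X : Ell2 κ) : Summable fun k => ‖X k‖ ^ 2 := by
  have := (lp.memℓp X).summable (by norm_num)
  simpa using this

theorem memℓp_two_of_summable {f : κ → ℂ} (hf : Summable fun k => ‖f k‖ ^ 2) : Memℓp f 2 :=
  memℓp_gen (by simpa using hf)

theorem hasSum_norm_sq (X : Ell2 κ) : HasSum (fun k => ‖X k‖ ^ 2) (‖X‖ ^ 2) := by
  have := lp.hasSum_norm (p := 2) (by norm_num) X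
  simpa using this

/-- The column with index `q` of a family indexed by `κ ≃ a × b`. -/
def fib (e : κ ≃ a × b) (X : Ell2 κ) (q : b) : Ell2 a :=
  ⟨fun x => X (e.symm (x, q)), memℓp_two_of_summable <|
    (summable_norm_sq X).comp_injective (i := fun x => e.symm (x, q)) fun x y h => by
      simpa using h⟩

@[simp]
theorem fib_apply (e : κ ≃ a × b) (X : Ell2 κ) (q : b) (x : a) :
    fib e X q x = X (e.symm (x, q)) := rfl

theorem hasSum_inner_fib (e : κ ≃ a × b) (X Y : Ell2 κ) :
    HasSum (fun q => ⟪fib e X q, fib e Y q⟫_ℂ) ⟪X, Y⟫_ℂ := by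
  have h := lp.hasSum_inner (𝕜 := ℂ) X Y
  rw [← ((Equiv.prodComm b a).trans e.symm).hasSum_iff] at h
  exact h.prod_fiberwise fun q => lp.hasSum_inner (𝕜 := ℂ) (fib e X q) (fib e Y q)

theorem hasSum_norm_sq_fib (e : κ ≃ a × b) (X : Ell2 κ) :
    HasSum (fun q => ‖fib e X q‖ ^ 2) (‖X‖ ^ 2) := by
  have h := hasSum_norm_sq X
  rw [← ((Equiv.prodComm b a).trans e.symm).hasSum_iff] at h
  exact h.prod_fiberwise fun q => hasSum_norm_sq (fib e X q)

theorem fib_injective {e : κ ≃ a × b} {X Y : Ell2 κ} (h : ∀ q, fib e X q = fib e Y q) : X = Y := by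
  ext k
  have := congrArg (fun Z : Ell2 a => Z (e k).1) (h (e k).2)
  simpa using this

/-- By Fubini the squared norm of a family is the sum of the squared norms of its columns, and `M`
acts on each column with bound `‖M‖`. -/
theorem memℓp_ampl (e : κ ≃ a × b) (M : Ell2 a →L[ℂ] Ell2 a) (X : Ell2 κ) :
    Memℓp (fun k => M (fib e X (e k).2) (e k).1) 2 := by
  refine memℓp_two_of_summable ?_
  rw [← ((Equiv.prodComm b a).trans e.symm).summable_iff]
  refine (summable_prod_of_nonneg fun _ => sq_nonneg _).2 ?_
  simp only [Equiv.trans_apply, Equiv.prodComm_apply, Prod.swap_prod_mk,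
    Equiv.apply_symm_apply]
  refine ⟨fun q => summable_norm_sq _, ?_⟩
  simp only [(hasSum_norm_sq _).tsum_eq]
  refine .of_nonneg_of_le (fun _ => by positivity) (fun q => ?_)
    ((hasSum_norm_sq_fib e X).summable.mul_left (‖M‖ ^ 2))
  rw [← mul_pow]
  gcongr
  exact M.le_opNorm _

/-- The operator `M ⊗ 1` on `ℓ²(κ)`, where `κ ≃ a × b`. -/
def ampl (e : κ ≃ a × b) (M : Ell2 a →L[ℂ] Ell2 a) : Ell2 κ →L[ℂ] Ell2 κ :=
  LinearMap.mkContinuous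
    { toFun := fun X => ⟨fun k => M (fib e X (e k).2) (e k).1, memℓp_ampl e M X⟩
      map_add' := fun X Y => by
        ext k
        have : fib e (X + Y) (e k).2 = fib e X (e k).2 + fib e Y (e k).2 := rfl
        change M (fib e (X + Y) (e k).2) (e k).1 = _
        rw [this, map_add]
        rfl
      map_smul' := fun c X => by
        ext k
        have : fib e (c • X) (e k).2 = c • fib e X (e k).2 := rfl
        change M (fib e (c • X) (e k).2) (e k).1 = _
        rw [this, map_smul]
        rfl } ‖M‖ fun X => by
    refine (sq_le_sq₀ (norm_nonneg _) (by positivity)).1 ?_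
    set Y : Ell2 κ := ⟨fun k => M (fib e X (e k).2) (e k).1, memℓp_ampl e M X⟩ with hY
    have hfib : ∀ q, fib e Y q = M (fib e X q) := fun q => by
      ext x
      change M (fib e X (e (e.symm (x, q))).2) (e (e.symm (x, q))).1 = _
      rw [e.apply_symm_apply]
    have h1 := hasSum_norm_sq_fib e Y
    have h2 := (hasSum_norm_sq_fib e X).mul_left (‖M‖ ^ 2)
    rw [mul_pow]
    refine hasSum_le (fun q => ?_) h1 h2
    rw [hfib, ← mul_pow]
    gcongr
    exact M.le_opNorm _

theorem ampl_apply (e : κ ≃ a × b) (M : Ell2 a →L[ℂ] Ell2 a) (X : Ell2 κ) (k : κ) :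
    ampl e M X k = M (fib e X (e k).2) (e k).1 := rfl

@[simp]
theorem fib_ampl (e : κ ≃ a × b) (M : Ell2 a →L[ℂ] Ell2 a) (X : Ell2 κ) (q : b) :
    fib e (ampl e M X) q = M (fib e X q) := by
  ext x
  rw [fib_apply, ampl_apply, e.apply_symm_apply]

theorem ampl_injective (e : κ ≃ a × b) {M : Ell2 a →L[ℂ] Ell2 a} (hM : Function.Injective M) :
    Function.Injective (ampl e M) := fun X Y h =>
  fib_injective (e := e) fun q => hM <| by rw [← fib_ampl, ← fib_ampl, h]

/-- Ampliation as a homomorphism of star algebras. -/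
def amplHom (e : κ ≃ a × b) : (Ell2 a →L[ℂ] Ell2 a) →⋆ₐ[ℂ] (Ell2 κ →L[ℂ] Ell2 κ) where
  toFun := ampl e
  map_one' := by ext X k; simp [ampl_apply]
  map_mul' M N := by
    ext1 X
    exact fib_injective (e := e) fun q => by simp
  map_zero' := by ext X k; simp [ampl_apply]
  map_add' M N := by ext X k; simp [ampl_apply]
  commutes' c := by ext X k; simp [ampl_apply, Algebra.algebraMap_eq_smul_one]
  map_star' M := by
    rw [ContinuousLinearMap.star_eq_adjoint, ContinuousLinearMap.star_eq_adjoint,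
      ContinuousLinearMap.eq_adjoint_iff]
    intro X Y
    have h1 := hasSum_inner_fib e (ampl e M.adjoint X) Y
    have h2 := hasSum_inner_fib e X (ampl e M Y)
    simp only [fib_ampl, ContinuousLinearMap.adjoint_inner_left] at h1 h2
    exact h1.unique h2

theorem memℓp_tens (e : κ ≃ a × b) (u : Ell2 a) (v : Ell2 b) :
    Memℓp (fun k => u (e k).1 * v (e k).2) 2 := by
  refine memℓp_two_of_summable ?_
  rw [← e.symm.summable_iff]
  have := (summable_norm_sq u).mul_of_nonneg (summable_norm_sq v) (fun _ => by positivity)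
    fun _ => by positivity
  refine this.congr fun k => ?_
  simp [mul_pow]

/-- The rank-one family `u ⊗ v` on `κ ≃ a × b`. -/
def tens (e : κ ≃ a × b) (u : Ell2 a) (v : Ell2 b) : Ell2 κ :=
  ⟨fun k => u (e k).1 * v (e k).2, memℓp_tens e u v⟩

theorem tens_apply (e : κ ≃ a × b) (u : Ell2 a) (v : Ell2 b) (k : κ) :
    tens e u v k = u (e k).1 * v (e k).2 := rfl

theorem ampl_tens (e : κ ≃ a × b) (M : Ell2 a →L[ℂ] Ell2 a) (u : Ell2 a) (v : Ell2 b) :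
    ampl e M (tens e u v) = tens e (M u) v := by
  ext k
  have : fib e (tens e u v) (e k).2 = v (e k).2 • u := by
    ext x
    simp [tens_apply, mul_comm]
  rw [ampl_apply, this, map_smul, tens_apply, mul_comm]
  rfl

end Ampliation

/-! ### Operators acting on one mode of a tensor -/

section Mode

variable {J : Type} [DecidableEq J] {κ : J → Type u}

theorem piSplitAt_symm_mk (j : J) (p : ∀ j, κ j) (x : κ j) :
    (Equiv.piSplitAt j κ).symm (x, (Equiv.piSplitAt j κ p).2) = Function.update p j x := by
  funext i
  rcases eq_or_ne i j with rfl | h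
  · simp
  · simp [h]

/-- The operator `1 ⊗ ⋯ ⊗ M ⊗ ⋯ ⊗ 1` with `M` acting on the mode `j`. -/
def modeOp (j : J) : (Ell2 (κ j) →L[ℂ] Ell2 (κ j)) →⋆ₐ[ℂ]
    (Ell2 (∀ j, κ j) →L[ℂ] Ell2 (∀ j, κ j)) :=
  amplHom (Equiv.piSplitAt j κ)

/-- The mode-`j` fiber through `p`. -/
def slice (j : J) (p : ∀ j, κ j) (X : Ell2 (∀ j, κ j)) : Ell2 (κ j) :=
  fib (Equiv.piSplitAt j κ) X (Equiv.piSplitAt j κ p).2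

theorem slice_apply (j : J) (p : ∀ j, κ j) (X : Ell2 (∀ j, κ j)) (x : κ j) :
    slice j p X x = X (Function.update p j x) := by
  rw [slice, fib_apply, piSplitAt_symm_mk]

theorem modeOp_apply (j : J) (M : Ell2 (κ j) →L[ℂ] Ell2 (κ j)) (X : Ell2 (∀ j, κ j))
    (p : ∀ j, κ j) : modeOp j M X p = M (slice j p X) (p j) := rfl

theorem modeOp_apply_of_eq_smul (j : J) (M : Ell2 (κ j) →L[ℂ] Ell2 (κ j)) {X : Ell2 (∀ j, κ j)}
    {p : ∀ j, κ j} {c : ℂ} {w : Ell2 (κ j)} (h : ∀ x, X (Function.update p j x) = c * w x) :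
    modeOp j M X p = c * M w (p j) := by
  have : slice j p X = c • w := by
    ext x
    rw [slice_apply, h]
    rfl
  rw [modeOp_apply, this, map_smul]
  rfl

theorem modeOp_injective (j : J) {M : Ell2 (κ j) →L[ℂ] Ell2 (κ j)} (hM : Function.Injective M) :
    Function.Injective (modeOp j M) :=
  ampl_injective _ hM

theorem modeOp_tens_left (P : J → Prop) [DecidablePred P] {j : J} (hj : P j)
    (M : Ell2 (κ j) →L[ℂ] Ell2 (κ j)) (u : Ell2 (∀ i : {i // P i}, κ i))
    (v : Ell2 (∀ i : {i // ¬ P i}, κ i)) :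
    modeOp j M (tens (Equiv.piEquivPiSubtypeProd P κ) u v) =
      tens (Equiv.piEquivPiSubtypeProd P κ)
        (modeOp (κ := fun i : {i // P i} => κ i) ⟨j, hj⟩ M u) v := by
  ext p
  rw [tens_apply, modeOp_apply (κ := fun i : {i // P i} => κ i), mul_comm]
  refine modeOp_apply_of_eq_smul j M fun x => ?_
  rw [tens_apply, slice_apply, mul_comm]
  congr 1
  · refine congrArg (fun q => v q) (funext fun i => ?_)
    have : (i : J) ≠ j := fun h => i.2 (h ▸ hj)
    simp [this]
  · refine congrArg (fun q => u q) (funext fun i => ?_)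
    rcases eq_or_ne i ⟨j, hj⟩ with rfl | h
    · simp
    · have : (i : J) ≠ j := fun h' => h (Subtype.ext h')
      simp [h, this]

theorem modeOp_tens_right (P : J → Prop) [DecidablePred P] {j : J} (hj : ¬ P j)
    (M : Ell2 (κ j) →L[ℂ] Ell2 (κ j)) (u : Ell2 (∀ i : {i // P i}, κ i))
    (v : Ell2 (∀ i : {i // ¬ P i}, κ i)) :
    modeOp j M (tens (Equiv.piEquivPiSubtypeProd P κ) u v) =
      tens (Equiv.piEquivPiSubtypeProd P κ) u
        (modeOp (κ := fun i : {i // ¬ P i} => κ i) ⟨j, hj⟩ M v) := by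
  ext p
  rw [tens_apply, modeOp_apply (κ := fun i : {i // ¬ P i} => κ i)]
  refine modeOp_apply_of_eq_smul j M fun x => ?_
  rw [tens_apply, slice_apply]
  congr 1
  · refine congrArg (fun q => u q) (funext fun i => ?_)
    have : (i : J) ≠ j := fun h => hj (h ▸ i.2)
    simp [this]
  · refine congrArg (fun q => v q) (funext fun i => ?_)
    rcases eq_or_ne i ⟨j, hj⟩ with rfl | h
    · simp
    · have : (i : J) ≠ j := fun h' => h (Subtype.ext h')
      simp [h, this]

theorem modeOp_tens_piSplitAt {i j : J} (hj : j ≠ i)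
    (M : Ell2 (κ j) →L[ℂ] Ell2 (κ j)) (u : Ell2 (κ i)) (v : Ell2 (∀ k : {k // k ≠ i}, κ k)) :
    modeOp j M (tens (Equiv.piSplitAt i κ) u v) =
      tens (Equiv.piSplitAt i κ) u
        (modeOp (κ := fun k : {k // k ≠ i} => κ k) ⟨j, hj⟩ M v) := by
  ext p
  rw [tens_apply, modeOp_apply (κ := fun k : {k // k ≠ i} => κ k)]
  refine modeOp_apply_of_eq_smul j M fun x => ?_
  rw [tens_apply, slice_apply]
  congr 1
  · simp [hj.symm]
  · refine congrArg (fun q => v q) (funext fun k => ?_)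
    rcases eq_or_ne k ⟨j, hj⟩ with rfl | h
    · simp
    · have : (k : J) ≠ j := fun h' => h (Subtype.ext h')
      simp [h, this]

end Mode

section Tensor

variable {d : ℕ} {ι : Fin d → Type u}

theorem elem_apply (v : ∀ i, Ell2 (ι i)) (p : ∀ i, ι i) : elem v p = ∏ i, v i (p i) := rfl

theorem elem_update_apply (v : ∀ i, Ell2 (ι i)) (j : Fin d) (w : Ell2 (ι j)) (p : ∀ i, ι i) :
    elem (Function.update v j w) p = (∏ i ∈ Finset.univ.erase j, v i (p i)) * w (p j) := by
  rw [elem_apply, ← Finset.prod_erase_mul _ _ (Finset.mem_univ j), Function.update_self]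
  congr 1
  refine Finset.prod_congr rfl fun i hi => ?_
  rw [Function.update_of_ne (Finset.ne_of_mem_erase hi)]

theorem modeOp_elem (j : Fin d) (M : Ell2 (ι j) →L[ℂ] Ell2 (ι j)) (v : ∀ i, Ell2 (ι i)) :
    modeOp j M (elem v) = elem (Function.update v j (M (v j))) := by
  ext p
  rw [elem_update_apply]
  refine modeOp_apply_of_eq_smul j M fun x => ?_
  rw [elem_apply, ← Finset.prod_erase_mul _ _ (Finset.mem_univ j), Function.update_self]
  congr 1
  refine Finset.prod_congr rfl fun i hi => ?_
  rw [Function.update_of_ne (Finset.ne_of_mem_erase hi)]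

theorem elem_update_smul (v : ∀ i, Ell2 (ι i)) (j : Fin d) (c : ℂ) (w : Ell2 (ι j)) :
    elem (Function.update v j (c • w)) = c • elem (Function.update v j w) := by
  ext p
  change elem (Function.update v j (c • w)) p = c * elem (Function.update v j w) p
  rw [elem_update_apply, elem_update_apply]
  change _ * (c * w (p j)) = _
  ring

/-- Coordinate vectors of the product index set are elementary tensors of coordinate vectors.
Identities between bounded operators can thus be checked on elementary tensors. -/
theorem dense_span_elem : Dense (Submodule.span ℂ (Set.range (elem (ι := ι))) : Set (Tensor ι)) := by
  classical
  intro X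
  have h := lp.hasSum_single (p := 2) (by norm_num) X
  refine mem_closure_of_tendsto h (.of_forall fun s => ?_)
  refine Submodule.sum_mem _ fun p _ => ?_
  have : (lp.single (E := fun _ => ℂ) 2 p (X p) : Tensor ι) = X p • elem fun i => lp.single (E := fun _ => ℂ) 2 (p i) 1 := by
    ext q
    change lp.single (E := fun _ => ℂ) 2 p (X p) q = X p * elem (fun i => lp.single (E := fun _ => ℂ) 2 (p i) 1) q
    rw [elem_apply, lp.single_apply]
    by_cases hq : q = p
    · subst hq
      simp
    · obtain ⟨i, hi⟩ := Function.ne_iff.1 hq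
      rw [Finset.prod_eq_zero (Finset.mem_univ i) (by simp [hi])]
      simp [hq]
  rw [this]
  exact Submodule.smul_mem _ _ (Submodule.subset_span ⟨_, rfl⟩)

theorem clm_ext_elem {F : Type*} [NormedAddCommGroup F] [NormedSpace ℂ F]
    {S T : Tensor ι →L[ℂ] F} (h : ∀ v, S (elem v) = T (elem v)) : S = T :=
  ContinuousLinearMap.ext_on dense_span_elem (by rintro _ ⟨v, rfl⟩; exact h v)

theorem commute_modeOp {i j : Fin d} (hij : i ≠ j) (M : Ell2 (ι i) →L[ℂ] Ell2 (ι i))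
    (N : Ell2 (ι j) →L[ℂ] Ell2 (ι j)) : Commute (modeOp i M) (modeOp j N) := by
  refine clm_ext_elem fun v => ?_
  simp only [mul_apply_eq_comp, modeOp_elem]
  rw [Function.update_of_ne hij, Function.update_of_ne hij.symm, Function.update_comm hij]

theorem prod_ofFn_modeOp_elem (M : ∀ i, Ell2 (ι i) →L[ℂ] Ell2 (ι i)) (v : ∀ i, Ell2 (ι i)) :
    (List.ofFn fun i => modeOp i (M i)).prod (elem v) = elem fun i => M i (v i) := by
  have key : ∀ l : List (Fin d), l.Nodup → (l.map fun i => modeOp i (M i)).prod (elem v) =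
      elem fun i => if i ∈ l then M i (v i) else v i := by
    intro l
    induction l with
    | nil => intro _; simp
    | cons j l ih =>
      intro hl
      rw [List.nodup_cons] at hl
      rw [List.map_cons, List.prod_cons, mul_apply_eq_comp, ih hl.2, modeOp_elem]
      congr 1
      funext i
      rcases eq_or_ne i j with rfl | hij
      · simp [hl.1]
      · simp [hij]
  have h := key (List.finRange d) (List.nodup_finRange d)
  simpa [List.ofFn_eq_map] using h

theorem prod_list_injective {H : Type*} [NormedAddCommGroup H] [NormedSpace ℂ H]
    (l : List (H →L[ℂ] H)) (hl : ∀ T ∈ l, Function.Injective T) : Function.Injective l.prod := by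
  induction l with
  | nil => exact Function.injective_id
  | cons T l ih =>
    rw [List.prod_cons]
    exact (hl T List.mem_cons_self).comp (ih fun S hS => hl S (List.mem_cons_of_mem _ hS))

theorem isSelfAdjoint_list_prod {A : Type*} [Semiring A] [StarRing A] (l : List A)
    (hsa : ∀ x ∈ l, IsSelfAdjoint x) (hc : ∀ x ∈ l, ∀ y ∈ l, Commute x y) :
    IsSelfAdjoint l.prod := by
  induction l with
  | nil => exact .one A
  | cons x l ih =>
    rw [List.prod_cons]
    have h := ih (fun y hy => hsa y (List.mem_cons_of_mem _ hy))
      fun y hy z hz => hc y (List.mem_cons_of_mem _ hy) z (List.mem_cons_of_mem _ hz)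
    exact ((hsa x List.mem_cons_self).commute_iff h).1 <|
      Commute.list_prod_right _ _ fun y hy => hc x List.mem_cons_self y (List.mem_cons_of_mem _ hy)

end Tensor

/-! ### Functional calculus of operators -/

section FunCalc

variable {H H₂ : Type u} [NormedAddCommGroup H] [InnerProductSpace ℂ H] [CompleteSpace H]
  [NormedAddCommGroup H₂] [InnerProductSpace ℂ H₂] [CompleteSpace H₂]

/-- The continuous functional calculus of a bounded self-adjoint operator. -/
def funCalc (f : ℝ → ℝ) (T : H →L[ℂ] H) : H →L[ℂ] H := cfc f T

theorem map_funCalc (φ : (H →L[ℂ] H) →⋆ₐ[ℂ] (H₂ →L[ℂ] H₂)) {f : ℝ → ℝ} (hf : Continuous f)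
    {T : H →L[ℂ] H} (hT : IsSelfAdjoint T) : φ (funCalc f T) = funCalc f (φ T) :=
  StarAlgHomClass.map_cfc (S := ℂ) φ f T hf.continuousOn (map_continuous φ) hT (hT.map φ)

theorem nonneg_of_funCalc_min_eq_zero {T : H →L[ℂ] H} (hT : IsSelfAdjoint T)
    (h : funCalc (fun x => min x 0) T = 0) : 0 ≤ T := by
  rw [StarOrderedRing.nonneg_iff_spectrum_nonneg (R := ℝ) T hT]
  intro x hx
  have := norm_apply_le_norm_cfc (fun x : ℝ => min x 0) T hx (by fun_prop) hT
  rw [funCalc] at h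
  rw [h, norm_zero, norm_le_zero_iff] at this
  exact min_eq_right_iff.1 this

theorem prod_mul_funCalc_eq_zero {d : ℕ} {r : Fin d → H →L[ℂ] H}
    {b : H →L[ℂ] H} (hr : ∀ i, IsSelfAdjoint (r i)) (hb : IsSelfAdjoint b)
    (hrr : ∀ i j, Commute (r i) (r j)) (hbr : ∀ i, Commute b (r i))
    (hspec : ∀ i, ∀ z ∈ spectrum ℂ (r i), 0 ≤ z.re ∧ z.re ≤ 1)
    (hrel : b * ∑ j, (List.ofFn (Function.update r j (1 - r j))).prod = (List.ofFn r).prod) :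
    (List.ofFn r).prod * funCalc (fun x : ℝ => min x 0) b = 0 ∧ ∀ t : ℝ, 0 < t →
      (List.ofFn r).prod *
        ((List.ofFn fun i => funCalc (fun x => Real.exp t * expNegInvGlue (x / t)) (r i)).prod -
          funCalc (fun x => expNegInvGlue (x / t)) b) = 0 :=
  prod_mul_cfc_eq_zero hr hb hrr hbr hspec hrel

/-- Both operators are functions of `T`, whose spectrum lies in `[0, ‖T‖]`, so a uniform scalar
bound there is a norm bound. -/
theorem norm_rpow_sub_sum_funCalc_le {T : H →L[ℂ] H} (hT : 0 ≤ T) {α : ℝ} (hα : 0 < α)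
    {N : ℕ} {w t : ℕ → ℝ} {ε : ℝ} (hε : 0 ≤ ε)
    (h : ∀ x : ℝ, 0 ≤ x → x ≤ ‖T‖ →
      |x ^ α - ∑ k ∈ Finset.range N, w k * expNegInvGlue (x / t k)| ≤ ε) :
    ‖T ^ α - ∑ k ∈ Finset.range N, (w k : ℂ) • funCalc (fun x => expNegInvGlue (x / t k)) T‖ ≤
      ε := by
  have hsa : IsSelfAdjoint T := .of_nonneg hT
  have h1 : T ^ α = cfc (fun x : ℝ => x ^ α) T := CFC.rpow_eq_cfc_real hT
  have hc : Continuous fun x : ℝ => x ^ α := Real.continuous_rpow_const hα.le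
  have h2 : ∑ k ∈ Finset.range N, (w k : ℂ) • funCalc (fun x => expNegInvGlue (x / t k)) T =
      cfc (fun x : ℝ => ∑ k ∈ Finset.range N, w k * expNegInvGlue (x / t k)) T := by
    have h3 := cfc_sum (fun k x => w k * expNegInvGlue (x / t k)) T (Finset.range N)
      (fun k _ => (continuous_const.mul (continuous_expNegInvGlue_div (t k))).continuousOn)
    have h4 : (fun x : ℝ => ∑ k ∈ Finset.range N, w k * expNegInvGlue (x / t k)) =
        ∑ k ∈ Finset.range N, fun x : ℝ => w k * expNegInvGlue (x / t k) := by
      funext x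
      rw [Finset.sum_apply]
    rw [h4, h3]
    refine Finset.sum_congr rfl fun k _ => ?_
    rw [cfc_const_mul (w k) _ T (continuous_expNegInvGlue_div (t k)).continuousOn]
    exact (RCLike.real_smul_eq_coe_smul (K := ℂ) _ _).symm
  have hc' : Continuous fun x : ℝ => ∑ k ∈ Finset.range N, w k * expNegInvGlue (x / t k) :=
    continuous_finsetSum _ fun k _ => continuous_const.mul (continuous_expNegInvGlue_div (t k))
  rw [h1, h2, ← cfc_sub _ _ T hc.continuousOn hc'.continuousOn]
  refine norm_cfc_le hε fun x hx => h x (spectrum_nonneg_of_nonneg hT hx) ?_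
  calc x ≤ ‖x‖ := Real.le_norm_self x
    _ ≤ ‖T‖ * ‖(1 : H →L[ℂ] H)‖ := spectrum.norm_le_norm_mul_of_mem hx
    _ ≤ ‖T‖ * 1 := by
        gcongr
        exact ContinuousLinearMap.norm_id_le
    _ = ‖T‖ := mul_one _

end FunCalc

/-! ### The inverse of a Kronecker sum -/

section Inverse

variable {d : ℕ} {ι : Fin d → Type u} {A : ∀ i, Ell2 (ι i) →ₗ.[ℂ] Ell2 (ι i)}
  {B : Tensor ι →L[ℂ] Tensor ι} {R : ∀ i, Ell2 (ι i) →L[ℂ] Ell2 (ι i)}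

/-- Invertibility alone makes the closed graph single-valued, so closability of the Kronecker sum
needs no separate proof and statements about the inverse can be read off the graph. -/
theorem graph_toLinearPMap_of_isBoundedInverse {H : Type u} [NormedAddCommGroup H]
    [InnerProductSpace ℂ H] [CompleteSpace H] {g : Submodule ℂ (H × H)} {B : H →L[ℂ] H}
    (hB : IsBoundedInverse g.toLinearPMap B) : g.toLinearPMap.graph = g := by
  classical
  by_cases hg : ∀ (x : H × H) (_ : x ∈ g) (_ : x.fst = 0), x.snd = 0
  · exact Submodule.toLinearPMap_graph_eq g hg
  · -- otherwise `g.toLinearPMap` is the junk value `0`, which is invertible only if `H` is trivial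
    refine absurd (fun x _ _ => ?_) hg
    obtain ⟨h, hx⟩ := hB.1 x.snd
    rw [← hx]
    change (if hg : _ then g.toLinearPMapAux hg else 0) _ = _
    rw [dif_neg hg]
    rfl

theorem isBoundedInverse_apply_eq (hB : IsBoundedInverse (kroneckerSum A) B) {x z : Tensor ι}
    (h : (x, z) ∈ (algKroneckerGraph A).topologicalClosure) : B z = x := by
  rw [← graph_toLinearPMap_of_isBoundedInverse hB] at h
  obtain ⟨y, hy, hz⟩ := (LinearPMap.mem_graph_iff _).1 h
  simp only at hy hz
  rw [← hy, ← hz]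
  exact hB.2 y

theorem isBoundedInverse_mem (hB : IsBoundedInverse (kroneckerSum A) B) (z : Tensor ι) :
    (B z, z) ∈ (algKroneckerGraph A).topologicalClosure := by
  obtain ⟨h, hz⟩ := hB.1 z
  rw [← graph_toLinearPMap_of_isBoundedInverse hB]
  exact (LinearPMap.mem_graph_iff _).2 ⟨⟨B z, h⟩, rfl, hz⟩

/-- The resolvent `R_i` commutes with `A_i` on its domain and, acting on another mode, with every
other summand. Passing to the closure gives commutation with `𝒜⁻¹`. -/
theorem modeOp_mem_algKroneckerGraph (hR : ∀ i, IsResolvent (A i) (R i)) (i : Fin d)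
    {x : Tensor ι × Tensor ι} (hx : x ∈ algKroneckerGraph A) :
    (modeOp i (R i) x.1, modeOp i (R i) x.2) ∈ algKroneckerGraph A := by
  refine Submodule.span_induction (p := fun x _ =>
    (modeOp i (R i) x.1, modeOp i (R i) x.2) ∈ algKroneckerGraph A) ?_ ?_ ?_ ?_ hx
  · rintro _ ⟨v, rfl⟩
    set v' : ∀ i, (A i).domain := Function.update v i ⟨R i (v i), (hR i).mem_domain _⟩ with hv'
    have hcoe : (fun k => (v' k : Ell2 (ι k))) =
        Function.update (fun k => (v k : Ell2 (ι k))) i (R i (v i)) := by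
      funext k
      rcases eq_or_ne k i with rfl | hk
      · simp [hv']
      · simp [hv', hk]
    refine Submodule.subset_span ⟨v', Prod.ext ?_ ?_⟩
    · simp only [modeOp_elem]
      rw [hcoe]
    · simp only [map_sum, modeOp_elem]
      refine Finset.sum_congr rfl fun j _ => ?_
      rw [hcoe]
      rcases eq_or_ne j i with rfl | hj
      · have h1 : A j (v' j) = R j (A j (v j)) := by
          have h2 := (hR j).map_add_apply (v j)
          rw [map_add] at h2
          rw [hv', Function.update_self, (hR j).apply_eq]
          exact sub_eq_of_eq_add' h2.symm
        rw [h1, Function.update_idem, Function.update_idem, Function.update_self]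
      · have h1 : v' j = v j := Function.update_of_ne hj _ _
        rw [h1, Function.update_comm hj, Function.update_of_ne hj.symm]
  · simp only [Prod.fst_zero, Prod.snd_zero, map_zero]
    exact (algKroneckerGraph A).zero_mem
  · intro x y _ _ hx hy
    simpa using add_mem hx hy
  · intro c x _ hx
    simpa using Submodule.smul_mem _ c hx

theorem commute_isBoundedInverse (hR : ∀ i, IsResolvent (A i) (R i))
    (hB : IsBoundedInverse (kroneckerSum A) B) (i : Fin d) : Commute B (modeOp i (R i)) := by
  ext1 z
  refine isBoundedInverse_apply_eq hB ?_
  exact map_mem_closure (f := fun x : Tensor ι × Tensor ι =>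
    (modeOp i (R i) x.1, modeOp i (R i) x.2)) (by fun_prop) (isBoundedInverse_mem hB z)
    fun x hx => modeOp_mem_algKroneckerGraph hR i hx

theorem update_modeOp (R : ∀ i, Ell2 (ι i) →L[ℂ] Ell2 (ι i)) (j : Fin d) :
    Function.update (fun i => modeOp i (R i)) j (1 - modeOp j (R j)) =
      fun i => modeOp i (Function.update R j (1 - R j) i) := by
  funext i
  rcases eq_or_ne i j with rfl | hij
  · simp
  · simp [hij]

/-- On `u₁ ⊗ ⋯ ⊗ u_d` the right side gives the tensor of the `R_i u_i`, which is in the algebraic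
domain of `𝒜`; there `𝒜` replaces one factor at a time by `A_j R_j u_j = (1 - R_j) u_j`. -/
theorem isBoundedInverse_mul_sum (hR : ∀ i, IsResolvent (A i) (R i))
    (hB : IsBoundedInverse (kroneckerSum A) B) :
    B * ∑ j, (List.ofFn (Function.update (fun i => modeOp i (R i)) j
      (1 - modeOp j (R j)))).prod = (List.ofFn fun i => modeOp i (R i)).prod := by
  refine clm_ext_elem fun u => isBoundedInverse_apply_eq hB ?_
  refine subset_closure (Submodule.subset_span ⟨fun i => ⟨R i (u i), (hR i).mem_domain _⟩, ?_⟩)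
  refine Prod.ext (prod_ofFn_modeOp_elem R u).symm ?_
  change ∑ j, elem (Function.update (fun i => R i (u i)) j
    (A j ⟨R j (u j), (hR j).mem_domain _⟩)) = (∑ j, (List.ofFn (Function.update (fun i => modeOp i (R i)) j
    (1 - modeOp j (R j)))).prod) (elem u)
  rw [sum_apply]
  refine Finset.sum_congr rfl fun j _ => ?_
  rw [update_modeOp, prod_ofFn_modeOp_elem, (hR j).apply_eq]
  congr 1
  funext i
  rcases eq_or_ne i j with rfl | hij
  · simp
  · simp [hij]

theorem IsResolvent.injective {H : Type u} [NormedAddCommGroup H] [InnerProductSpace ℂ H]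
    [CompleteSpace H] {A : H →ₗ.[ℂ] H} {R : H →L[ℂ] H} (hR : IsResolvent A R) :
    Function.Injective R := by
  rw [injective_iff_map_eq_zero]
  intro y hy
  have h := hR.apply_eq y
  have h0 : (⟨R y, hR.mem_domain y⟩ : A.domain) = 0 := Subtype.ext hy
  rw [h0, LinearPMap.map_zero, hy, sub_zero] at h
  exact h.symm

theorem prod_modeOp_injective (hR : ∀ i, IsResolvent (A i) (R i)) :
    Function.Injective (List.ofFn fun i => modeOp i (R i)).prod := by
  refine prod_list_injective _ fun T hT => ?_
  obtain ⟨i, rfl⟩ := (List.mem_ofFn' _ _).1 hT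
  exact modeOp_injective i (hR i).injective

theorem commute_modeOp_family {M N : ∀ i, Ell2 (ι i) →L[ℂ] Ell2 (ι i)}
    (h : ∀ i, Commute (M i) (N i)) (i j : Fin d) : Commute (modeOp i (M i)) (modeOp j (N j)) := by
  rcases eq_or_ne i j with rfl | hij
  · exact (h i).map (modeOp i)
  · exact commute_modeOp hij _ _

theorem isSelfAdjoint_prod_modeOp {M : ∀ i, Ell2 (ι i) →L[ℂ] Ell2 (ι i)}
    (hM : ∀ i, IsSelfAdjoint (M i)) : IsSelfAdjoint (List.ofFn fun i => modeOp i (M i)).prod := by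
  refine isSelfAdjoint_list_prod _ (fun T hT => ?_) fun S hS T hT => ?_
  · obtain ⟨i, rfl⟩ := (List.mem_ofFn' _ _).1 hT
    exact (hM i).map (modeOp i)
  · obtain ⟨i, rfl⟩ := (List.mem_ofFn' _ _).1 hS
    obtain ⟨j, rfl⟩ := (List.mem_ofFn' _ _).1 hT
    exact commute_modeOp_family (fun i => Commute.refl (M i)) i j

/-- Write the relation as `B Q = P` with `P`, `Q` self-adjoint. Taking adjoints and using that `B`
commutes with `Q` gives `Q B* = P = Q B`, and `Q` is injective because `P` is. Self-adjointness of
`𝒜` itself is not needed. -/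
theorem isSelfAdjoint_of_isBoundedInverse (hR : ∀ i, IsResolvent (A i) (R i))
    (hB : IsBoundedInverse (kroneckerSum A) B) : IsSelfAdjoint B := by
  have hrel := isBoundedInverse_mul_sum hR hB
  set P := (List.ofFn fun i => modeOp i (R i)).prod with hP
  set Q := ∑ j, (List.ofFn (Function.update (fun i => modeOp i (R i)) j
    (1 - modeOp j (R j)))).prod with hQ
  have hQinj : Function.Injective Q := by
    refine Function.Injective.of_comp (f := B) ?_
    have : ⇑B ∘ ⇑Q = ⇑P := by rw [← hrel]; rfl
    rw [this]
    exact prod_modeOp_injective hR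
  have hPsa : IsSelfAdjoint P := isSelfAdjoint_prod_modeOp fun i => (hR i).isSelfAdjoint
  have hQsa : IsSelfAdjoint Q := by
    refine isSelfAdjoint_sum _ fun j _ => ?_
    rw [update_modeOp]
    refine isSelfAdjoint_prod_modeOp fun i => ?_
    rcases eq_or_ne i j with rfl | hij
    · rw [Function.update_self]
      exact (IsSelfAdjoint.one _).sub (hR i).isSelfAdjoint
    · rw [Function.update_of_ne hij]
      exact (hR i).isSelfAdjoint
  have hcomm : Commute B Q := by
    refine Commute.sum_right _ _ _ fun j _ => Commute.list_prod_right _ _ fun T hT => ?_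
    obtain ⟨i, rfl⟩ := (List.mem_ofFn' _ _).1 hT
    rcases eq_or_ne i j with rfl | hij
    · rw [Function.update_self]
      exact (Commute.one_right B).sub_right (commute_isBoundedInverse hR hB i)
    · rw [Function.update_of_ne hij]
      exact commute_isBoundedInverse hR hB i
  have h1 : Q * star B = P := by
    have := congrArg star hrel
    rwa [star_mul, hQsa.star_eq, hPsa.star_eq] at this
  have h2 : Q * star B = Q * B := by rw [h1, ← hrel, hcomm.eq]
  ext1 z
  exact hQinj (congrArg (fun T : Tensor ι →L[ℂ] Tensor ι => T z) h2)

/-- The inverse of an invertible Kronecker sum is positive, and `exp (-t 𝒜)`, expressed through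
`𝒜⁻¹`, is the tensor product of the operators `exp (-t A_i)`, expressed through `(1 + A_i)⁻¹`. -/
theorem nonneg_and_funCalc_of_isBoundedInverse (hR : ∀ i, IsResolvent (A i) (R i))
    (hB : IsBoundedInverse (kroneckerSum A) B) :
    0 ≤ B ∧ ∀ t : ℝ, 0 < t → funCalc (fun x => expNegInvGlue (x / t)) B =
      (List.ofFn fun i => modeOp i
        (funCalc (fun x => Real.exp t * expNegInvGlue (x / t)) (R i))).prod := by
  have hBsa := isSelfAdjoint_of_isBoundedInverse hR hB
  have hsa : ∀ i, IsSelfAdjoint (modeOp i (R i)) := fun i => (hR i).isSelfAdjoint.map (modeOp i)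
  obtain ⟨h1, h2⟩ := prod_mul_funCalc_eq_zero (r := fun i => modeOp i (R i)) (b := B) hsa hBsa
    (commute_modeOp_family fun i => Commute.refl (R i)) (commute_isBoundedInverse hR hB)
    (fun i z hz => (hR i).spectrum_re z (AlgHom.spectrum_apply_subset (modeOp i) (R i) hz))
    (isBoundedInverse_mul_sum hR hB)
  have hcancel : ∀ D : Tensor ι →L[ℂ] Tensor ι,
      (List.ofFn fun i => modeOp i (R i)).prod * D = 0 → D = 0 := by
    intro D hD
    ext1 z
    refine prod_modeOp_injective hR ?_
    have := congrArg (fun T : Tensor ι →L[ℂ] Tensor ι => T z) hD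
    simpa using this
  refine ⟨nonneg_of_funCalc_min_eq_zero hBsa (hcancel _ h1), ?_⟩
  intro t ht
  rw [← sub_eq_zero.1 (hcancel _ (h2 t ht))]
  congr 2
  funext i
  exact (map_funCalc (modeOp i) (continuous_const.mul (continuous_expNegInvGlue_div t))
    (hR i).isSelfAdjoint).symm

end Inverse

/-! ### Sums of rank-one terms -/

section SumOf

variable {E γ : Type*} [AddCommGroup E] {g : γ → E}

/-- `X` is a sum of at most `r` values of `g`. -/
def IsSumOf (g : γ → E) (r : ℕ) (X : E) : Prop :=
  ∃ l : List γ, l.length ≤ r ∧ X = (l.map g).sum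

theorem IsSumOf.map [Module ℂ E] {r : ℕ} {X : E} (h : IsSumOf g r X) (T : E →ₗ[ℂ] E)
    (hT : ∀ x, ∃ y, T (g x) = g y) : IsSumOf g r (T X) := by
  obtain ⟨l, hl, rfl⟩ := h
  choose T' hT' using hT
  refine ⟨l.map T', by simpa using hl, ?_⟩
  rw [map_list_sum, List.map_map, List.map_map]
  congr 2
  exact funext hT'

theorem IsSumOf.add {r s : ℕ} {X Y : E} (hX : IsSumOf g r X) (hY : IsSumOf g s Y) :
    IsSumOf g (r + s) (X + Y) := by
  obtain ⟨l, hl, rfl⟩ := hX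
  obtain ⟨m, hm, rfl⟩ := hY
  exact ⟨l ++ m, by rw [List.length_append]; exact add_le_add hl hm, by simp⟩

theorem IsSumOf.sum_range {r : ℕ} (N : ℕ) {X : ℕ → E} (hX : ∀ k, IsSumOf g r (X k)) :
    IsSumOf g (N * r) (∑ k ∈ Finset.range N, X k) := by
  induction N with
  | zero => exact ⟨[], by simp, by simp⟩
  | succ N ih =>
    rw [Finset.sum_range_succ, Nat.succ_mul]
    exact ih.add (hX N)

end SumOf

/-! ### Ranks as numbers of rank-one terms, and their stability under mode operators -/

section Ranks

variable {d : ℕ} {ι : Fin d → Type u}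

theorem cpRank_le_iff {X : Tensor ι} {r : ℕ} : cpRank X ≤ r ↔ IsSumOf elem r X := by
  constructor
  · intro h
    by_contra hX
    have : ((r + 1 : ℕ) : ℕ∞) ≤ cpRank X := by
      refine le_iInf₂ fun k hk => ?_
      obtain ⟨v, hv⟩ := hk
      by_contra hlt
      have hkr : k ≤ r := by
        rw [Nat.cast_le] at hlt
        omega
      exact hX ⟨List.ofFn v, by simpa using hkr, by rw [hv, List.map_ofFn, List.sum_ofFn]; rfl⟩
    have := this.trans h
    rw [Nat.cast_le] at this
    omega
  · rintro ⟨l, hl, rfl⟩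
    refine (iInf₂_le l.length ⟨l.get, ?_⟩).trans (by exact_mod_cast hl)
    rw [← List.sum_ofFn]
    congr 1
    conv_lhs => rw [← List.ofFn_get l]
    rw [List.map_ofFn]
    rfl

/-- The algebraic rank of an unfolding is attained by square-summable factors: expand the columns in
an orthonormal basis of their finite-dimensional span. -/
theorem eRank_le_iff {κ a b : Type u} (e : κ ≃ a × b) (X : Ell2 κ) (r : ℕ) :
    Matrix.eRank (Matrix.of fun x q => X (e.symm (x, q))) ≤ r ↔
      IsSumOf (fun w : Ell2 a × Ell2 b => tens e w.1 w.2) r X := by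
  classical
  set m : Matrix a b ℂ := Matrix.of fun x q => X (e.symm (x, q)) with hm
  have hcol : ∀ q, m.col q = fun x => fib e X q x := fun q => rfl
  rw [Matrix.eRank, Cardinal.toENat_le_natCast, Matrix.cRank]
  constructor
  · intro h
    let c : Ell2 a →ₗ[ℂ] (a → ℂ) :=
      { toFun := fun v x => v x, map_add' := fun _ _ => rfl, map_smul' := fun _ _ => rfl }
    have hc : Function.Injective c := fun v w h => lp.ext h
    set V : Submodule ℂ (Ell2 a) := Submodule.span ℂ (Set.range (fib e X)) with hV
    have hmap : V.map c = Submodule.span ℂ (Set.range m.col) := by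
      rw [hV, Submodule.map_span, ← Set.range_comp]
      rfl
    have hrank : Module.rank ℂ V ≤ r := by
      rw [(Submodule.equivMapOfInjective c hc V).rank_eq, hmap]
      exact h
    have hfin : FiniteDimensional ℂ V :=
      Module.rank_lt_aleph0_iff.1 (hrank.trans_lt (Cardinal.natCast_lt_aleph0))
    have hfr : Module.finrank ℂ V ≤ r := Module.finrank_le_of_rank_le hrank
    let B := stdOrthonormalBasis ℂ V
    have hmem : ∀ q, fib e X q ∈ V := fun q => Submodule.subset_span ⟨q, rfl⟩
    -- Each coefficient is bounded by the norm of its column, by Cauchy–Schwarz, and the squared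
    -- column norms are summable.
    let w : Fin (Module.finrank ℂ V) → Ell2 b := fun s =>
      ⟨fun q => ⟪(B s : Ell2 a), fib e X q⟫_ℂ, memℓp_two_of_summable <|
        .of_nonneg_of_le (fun _ => by positivity) (fun q => by
          gcongr
          refine (norm_inner_le_norm (𝕜 := ℂ) (B s : Ell2 a) (fib e X q)).trans_eq ?_
          have : ‖(B s : Ell2 a)‖ = 1 := B.norm_eq_one s
          rw [this, one_mul]) (hasSum_norm_sq_fib e X).summable⟩
    refine ⟨List.ofFn fun s => ((B s : Ell2 a), w s), by simpa using hfr, ?_⟩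
    rw [List.map_ofFn, List.sum_ofFn]
    refine fib_injective (e := e) fun q => ?_
    have h1 := congrArg (Submodule.subtype V) (B.sum_repr' ⟨fib e X q, hmem q⟩)
    rw [map_sum] at h1
    refine h1.symm.trans ?_
    ext x
    rw [fib_apply]
    simp only [lp.coeFn_sum, Finset.sum_apply]
    refine Finset.sum_congr rfl fun s _ => ?_
    simp only [Function.comp_apply, tens_apply, Equiv.apply_symm_apply]
    exact mul_comm _ _
  · rintro ⟨l, hl, hX⟩
    set s : Finset (a → ℂ) := (l.map fun w x => w.1 x).toFinset with hs
    have hsub : Submodule.span ℂ (Set.range m.col) ≤ Submodule.span ℂ (s : Set (a → ℂ)) := by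
      rw [Submodule.span_le]
      rintro _ ⟨q, rfl⟩
      have h1 : m.col q = (l.map fun w => w.2 q • fun x => w.1 x).sum := by
        have key : ∀ l : List (Ell2 a × Ell2 b),
            (fun x => (l.map fun w => tens e w.1 w.2).sum (e.symm (x, q))) =
              (l.map fun w => w.2 q • fun x => w.1 x).sum := by
          intro l
          induction l with
          | nil => rfl
          | cons w l ih =>
            rw [List.map_cons, List.sum_cons, List.map_cons, List.sum_cons, ← ih]
            funext x
            change tens e w.1 w.2 (e.symm (x, q)) + _ = w.2 q * w.1 x + _
            rw [tens_apply, e.apply_symm_apply, mul_comm]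
        rw [hcol, ← key, ← hX]
        rfl
      rw [h1]
      refine list_sum_mem fun y hy => ?_
      obtain ⟨w, hw, rfl⟩ := List.mem_map.1 hy
      refine Submodule.smul_mem _ _ (Submodule.subset_span ?_)
      rw [hs]
      simp only [List.coe_toFinset, Set.mem_ofPred_eq]
      exact List.mem_map.2 ⟨w, hw, rfl⟩
    refine (Submodule.rank_mono hsub).trans ((rank_span_finset_le s).trans ?_)
    exact_mod_cast (List.toFinset_card_le _).trans (by simpa using hl)

theorem multilinearRank_le_iff {X : Tensor ι} {i : Fin d} {r : ℕ} : multilinearRank X i ≤ r ↔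
    IsSumOf (fun w : Ell2 (ι i) × Ell2 (∀ j : {j // j ≠ i}, ι j) =>
      tens (Equiv.piSplitAt i ι) w.1 w.2) r X :=
  eRank_le_iff _ X r

theorem ttRank_le_iff {X : Tensor ι} {k : Fin (d - 1)} {r : ℕ} : ttRank X k ≤ r ↔
    IsSumOf (fun w : Ell2 (∀ j : {j : Fin d // j.val < k.val + 1}, ι j) ×
        Ell2 (∀ j : {j : Fin d // ¬ j.val < k.val + 1}, ι j) =>
      tens (Equiv.piEquivPiSubtypeProd (fun j : Fin d => j.val < k.val + 1) ι) w.1 w.2) r X :=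
  eRank_le_iff _ X r

/-- The range of `g` is stable under scalars and under operators that act on a single mode. -/
structure ModeStable {γ : Type*} (g : γ → Tensor ι) : Prop where
  smul : ∀ (c : ℂ) (x : γ), ∃ y, c • g x = g y
  modeOp : ∀ (j : Fin d) (M : Ell2 (ι j) →L[ℂ] Ell2 (ι j)) (x : γ), ∃ y, modeOp j M (g x) = g y

theorem ModeStable.prod_modeOp {γ : Type*} {g : γ → Tensor ι} (hg : ModeStable g)
    (M : ∀ i, Ell2 (ι i) →L[ℂ] Ell2 (ι i)) (x : γ) :
    ∃ y, (List.ofFn fun i => FracKron.modeOp i (M i)).prod (g x) = g y := by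
  rw [List.ofFn_eq_map]
  induction List.finRange d with
  | nil => exact ⟨x, rfl⟩
  | cons i l ih =>
    obtain ⟨y, hy⟩ := ih
    obtain ⟨z, hz⟩ := hg.modeOp i (M i) y
    exact ⟨z, by rw [List.map_cons, List.prod_cons, mul_apply_eq_comp, hy, hz]⟩

theorem ModeStable.isSumOf_sum {γ : Type*} {g : γ → Tensor ι} (hg : ModeStable g) (N : ℕ)
    (w : ℕ → ℂ) (M : ℕ → ∀ i, Ell2 (ι i) →L[ℂ] Ell2 (ι i)) {r : ℕ} {C : Tensor ι}
    (hC : IsSumOf g r C) :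
    IsSumOf g (N * r) (∑ k ∈ Finset.range N,
      w k • (List.ofFn fun i => FracKron.modeOp i (M k i)).prod C) :=
  IsSumOf.sum_range N fun k =>
    hC.map ((w k • (List.ofFn fun i => FracKron.modeOp i (M k i)).prod : Tensor ι →L[ℂ] Tensor ι) :
      Tensor ι →ₗ[ℂ] Tensor ι) fun x => by
    obtain ⟨y, hy⟩ := hg.prod_modeOp (M k) x
    obtain ⟨z, hz⟩ := hg.smul (w k) y
    exact ⟨z, by rw [← hz, ← hy]; rfl⟩

/-- The mode `j` is needed to absorb a scalar into a factor: for `d = 0` the only elementary tensor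
is the constant `1`. -/
theorem modeStable_elem (j : Fin d) : ModeStable (elem (ι := ι)) where
  smul c v := ⟨Function.update v j (c • v j), by
    rw [elem_update_smul, Function.update_eq_self]⟩
  modeOp i M v := ⟨_, modeOp_elem i M v⟩

theorem smul_tens {κ a b : Type u} (e : κ ≃ a × b) (c : ℂ) (u : Ell2 a) (v : Ell2 b) :
    c • tens e u v = tens e (c • u) v := by
  ext k
  exact (mul_assoc c (u (e k).1) (v (e k).2)).symm

theorem modeStable_tens_piSplitAt (i : Fin d) :
    ModeStable fun w : Ell2 (ι i) × Ell2 (∀ j : {j // j ≠ i}, ι j) =>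
      tens (Equiv.piSplitAt i ι) w.1 w.2 where
  smul c w := ⟨(c • w.1, w.2), smul_tens _ _ _ _⟩
  modeOp j M w := by
    rcases eq_or_ne j i with rfl | hj
    · exact ⟨(M w.1, w.2), ampl_tens _ M w.1 w.2⟩
    · exact ⟨(w.1, FracKron.modeOp (κ := fun k : {k // k ≠ i} => ι k) ⟨j, hj⟩ M w.2),
        modeOp_tens_piSplitAt hj M w.1 w.2⟩

theorem modeStable_tens_piEquivPiSubtypeProd (P : Fin d → Prop) [DecidablePred P] :
    ModeStable fun w : Ell2 (∀ j : {j // P j}, ι j) × Ell2 (∀ j : {j // ¬ P j}, ι j) =>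
      tens (Equiv.piEquivPiSubtypeProd P ι) w.1 w.2 where
  smul c w := ⟨(c • w.1, w.2), smul_tens _ _ _ _⟩
  modeOp j M w := by
    by_cases hj : P j
    · exact ⟨(FracKron.modeOp (κ := fun k : {k // P k} => ι k) ⟨j, hj⟩ M w.1, w.2),
        modeOp_tens_left P hj M w.1 w.2⟩
    · exact ⟨(w.1, FracKron.modeOp (κ := fun k : {k // ¬ P k} => ι k) ⟨j, hj⟩ M w.2),
        modeOp_tens_right P hj M w.1 w.2⟩

end Ranks

/-- A Kronecker sum of no operators is not invertible. -/
theorem pos_of_isBoundedInverse {d : ℕ} {ι : Fin d → Type u}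
    {A : ∀ i, Ell2 (ι i) →ₗ.[ℂ] Ell2 (ι i)} {B : Tensor ι →L[ℂ] Tensor ι}
    (hB : IsBoundedInverse (kroneckerSum A) B) : 0 < d := by
  rcases Nat.eq_zero_or_pos d with rfl | hd
  · exfalso
    have h : ((elem fun i => i.elim0 : Tensor ι), (0 : Tensor ι)) ∈
        (algKroneckerGraph A).topologicalClosure :=
      subset_closure (Submodule.subset_span ⟨fun i => i.elim0, Prod.ext
        (congrArg elem (funext fun i => i.elim0)) (by simp)⟩)
    have h1 := isBoundedInverse_apply_eq hB h
    rw [map_zero] at h1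
    have h2 := congrArg (fun X : Tensor ι => X fun i => i.elim0) h1
    simp [elem_apply] at h2
  · exact hd

/-- Rescaling an exponential sum for `l ^ (-α)` on `[1, ∞)` to `(0, β]` in the variable `l⁻¹`. -/
theorem abs_rpow_sub_sum_expNegInvGlue_le {α β s ε : ℝ} (hα : 0 < α) (hβ : 0 ≤ β) (hs : 0 < β → s = β)
    (hε : 0 ≤ ε) {N : ℕ} {w t : ℕ → ℝ} (ht : ∀ k, 0 < t k)
    (h : ∀ l : ℝ, 1 ≤ l → |l ^ (-α) - ∑ k ∈ Finset.range N, w k * Real.exp (-(t k * l))| ≤ ε)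
    {x : ℝ} (hx₀ : 0 ≤ x) (hx : x ≤ β) :
    |x ^ α - ∑ k ∈ Finset.range N, β ^ α * w k * expNegInvGlue (x / (t k * s))| ≤ β ^ α * ε := by
  -- At `x = 0` the power and all terms of the sum vanish. For `x > 0` the scalar estimate is
  -- applied at `l = β / x ≥ 1`.
  rcases hx₀.eq_or_lt with rfl | hx₀
  · rw [Real.zero_rpow hα.ne', Finset.sum_eq_zero fun k _ => by
      rw [zero_div, expNegInvGlue.zero, mul_zero]]
    simp only [sub_zero, abs_zero]
    positivity
  · have hβ₀ : 0 < β := hx₀.trans_le hx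
    rw [hs hβ₀]
    have h1 := h (β / x) ((one_le_div hx₀).2 hx)
    have h2 : x ^ α - ∑ k ∈ Finset.range N, β ^ α * w k * expNegInvGlue (x / (t k * β)) =
        β ^ α * ((β / x) ^ (-α) - ∑ k ∈ Finset.range N, w k * Real.exp (-(t k * (β / x)))) := by
      rw [mul_sub, Finset.mul_sum]
      congr 1
      · rw [Real.rpow_neg (by positivity), Real.div_rpow hβ hx₀.le, inv_div,
          mul_div_cancel₀ _ (Real.rpow_pos_of_pos hβ₀ α).ne']
      · refine Finset.sum_congr rfl fun k _ => ?_
        rw [expNegInvGlue_of_pos (div_pos hx₀ (mul_pos (ht k) hβ₀)), inv_div, mul_assoc,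
          mul_div_assoc]
    rw [h2, abs_mul, abs_of_nonneg (by positivity)]
    gcongr

end FracKron

end

/-! ### Assembly of the approximant -/

open FracKron in
theorem theorem3p6 (α : ℝ) (hα₀ : 0 < α) (hα₁ : α < 1) :
    ∃ K : ℝ, 0 < K ∧
      ∀ (d : ℕ) (ι : Fin d → Type u) (A : ∀ i, Ell2 (ι i) →ₗ.[ℂ] Ell2 (ι i)),
        (∀ i, IsSPD (A i)) → IsInvertible (kroneckerSum A) →
        ∀ C X : Tensor ι, X = negPow (kroneckerSum A) α C →
        ∀ N : ℕ, ∃ XN : Tensor ι,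
          ‖X - XN‖ ≤ K * ‖boundedInverse (kroneckerSum A)‖ ^ α * ‖C‖ *
            Real.exp (-(Real.pi / 2) * Real.sqrt (α * N)) ∧
          (∀ r : ℕ, cpRank C ≤ r → cpRank XN ≤ (N * r : ℕ)) ∧
          (∀ r : Fin d → ℕ, (∀ i, multilinearRank C i ≤ r i) →
            ∀ i, multilinearRank XN i ≤ (N * r i : ℕ)) ∧
          (∀ r : Fin (d - 1) → ℕ, (∀ k, ttRank C k ≤ r k) →
            ∀ k, ttRank XN k ≤ (N * r k : ℕ)) := by
  obtain ⟨K, hK, happrox⟩ := exists_expSum_approx_rpow_neg hα₀ hα₁.le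
  refine ⟨K, hK, fun d ι A hA hinv C X hX N => ?_⟩
  obtain ⟨w, t, ht, hwt⟩ := happrox N
  have hB : IsBoundedInverse (kroneckerSum A) (boundedInverse (kroneckerSum A)) := by
    rw [boundedInverse, dif_pos hinv]
    exact hinv.choose_spec
  rw [negPow] at hX
  set B := boundedInverse (kroneckerSum A)
  choose R hR using fun i => (hA i).exists_isResolvent
  obtain ⟨hpos, hcalc⟩ := nonneg_and_funCalc_of_isBoundedInverse hR hB
  set ε := K * Real.exp (-(Real.pi / 2) * Real.sqrt (α * N)) with hε
  have hε₀ : 0 ≤ ε := by positivity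
  set β := ‖B‖ with hβ
  -- The exponents scale with `‖𝒜⁻¹‖`. The value `1` keeps them positive in the degenerate case
  -- `‖𝒜⁻¹‖ = 0`, where only `x = 0` has to be estimated.
  set s : ℝ := if β = 0 then 1 else β with hs
  have hβ₀ : 0 ≤ β := norm_nonneg B
  have hs₀ : 0 < s := by
    rw [hs]
    split_ifs with h
    exacts [one_pos, hβ₀.lt_of_ne' h]
  have hnorm := norm_rpow_sub_sum_funCalc_le hpos hα₀ (N := N) (w := fun k => β ^ α * w k)
    (t := fun k => t k * s) (ε := β ^ α * ε) (by positivity) fun x hx₀ hx =>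
      abs_rpow_sub_sum_expNegInvGlue_le hα₀ hβ₀ (fun h => if_neg h.ne') hε₀ ht hwt hx₀ hx
  set M : ℕ → ∀ i, Ell2 (ι i) →L[ℂ] Ell2 (ι i) := fun k i =>
    funCalc (fun x => Real.exp (t k * s) * expNegInvGlue (x / (t k * s))) (R i)
  rw [Finset.sum_congr rfl fun k _ => by rw [hcalc (t k * s) (mul_pos (ht k) hs₀)]] at hnorm
  refine ⟨∑ k ∈ Finset.range N, ((β ^ α * w k : ℝ) : ℂ) •
    (List.ofFn fun i => modeOp i (M k i)).prod C, ?_, fun r hC => ?_, fun r hC i => ?_,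
    fun r hC k => ?_⟩
  · have h1 := ContinuousLinearMap.le_of_opNorm_le _ hnorm C
    rw [sub_apply, sum_apply] at h1
    rw [hX]
    refine (le_of_eq ?_).trans (h1.trans_eq ?_)
    · rfl
    · rw [hε]
      ring
  · exact cpRank_le_iff.2 ((modeStable_elem ⟨0, pos_of_isBoundedInverse hB⟩).isSumOf_sum N _ M
      (cpRank_le_iff.1 hC))
  · exact multilinearRank_le_iff.2 ((modeStable_tens_piSplitAt i).isSumOf_sum N _ M
      (multilinearRank_le_iff.1 (hC i)))
  · exact ttRank_le_iff.2 ((modeStable_tens_piEquivPiSubtypeProd _).isSumOf_sum N _ M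
      (ttRank_le_iff.1 (hC k)))
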